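/- Let $W$ be an irreducible finite real reflection group of rank $n\ge 1$ acting on $\mathbb{R}^n$, and for a nonzero vector $\tau$ let $R(\tau)$ be the orthogonal reflection in the hyperplane $\tau^\perp$. Fix a chamber $C$ of $W$, let $\alpha_1,\dots,\alpha_n$ be the inward unit normals of $C$, and assume that, for some $0\le s\le n$, each of the sets $S_1=\{\alpha_1,\dots,\alpha_s\}$ and $S_2=\{\alpha_{s+1},\dots,\alpha_n\}$ is orthonormal. Let $c=R(\alpha_1)R(\alpha_2)\cdots R(\alpha_n)$ be the bipartite Coxeter element, $h$ its order, and $c_+=R(\alpha_1)\cdots R(\alpha_s)$. For $w\in W$ let $\ell(w)$ be the least number $k\ge 0$ such that $w$ is a product of $k$ reflections of $W$. For $i\ge 1$ put $\rho_i=R(\alpha_1)R(\alpha_2)\cdots R(\alpha_{i-1})(\alpha_i)$, where the indices of the $\alpha$'s are read cyclically modulo $n$, and put $\rho_{-k}=\rho_{nh-k}$ for $0\le k<nh$. Let $EX(c)$ be the (abstract) simplicial complex whose vertices are the roots $\rho_{-n+s+1},\dots,\rho_0,\rho_1,\dots,\rho_{nh/2+s}$ and which has a simplex on a nonempty set $\{\tau_1,\dots,\tau_k\}$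 of them, listed as $\tau_1<\dots<\tau_k$ in the order of this list, exactly when $\ell(R(\tau_1)\cdots R(\tau_k)c)=n-k$. Let $AX(c)=c_+(EX(c))$ be its image under the linear map $c_+$. Then the roots $\rho_1,\dots,\rho_{nh/2+n}$ are pairwise distinct, the vertex set of $AX(c)$ is $\{\rho_1,\dots,\rho_{nh/2+n}\}$, and for all $k\ge 1$ and all roots $\tau_1<\tau_2<\dots<\tau_k$ from the list $\rho_1,\rho_2,\dots,\rho_{nh/2+n}$ (in the order of this list), the set $\{\tau_1,\dots,\tau_k\}$ spans a simplex of $AX(c)$ if and only if $$\ell\bigl(R(\tau_1)\cdots R(\tau_k)\,c\bigr)=n-k .$$ -/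

import Mathlib

namespace BipartiteCoxeter

/-- Euclidean space `ℝⁿ` with its standard inner product. -/
abbrev Euc (n : ℕ) : Type := EuclideanSpace ℝ (Fin n)

/-- The group of linear isometries of `ℝⁿ`; the product is composition. -/
abbrev Orth (n : ℕ) : Type := Euc n ≃ₗᵢ[ℝ] Euc n

/-- `R(τ)`: the orthogonal reflection in the hyperplane `τ^⊥` (used for `τ ≠ 0`). -/
noncomputable def R {n : ℕ} (τ : Euc n) : Orth n := (Submodule.span ℝ {τ})ᗮ.reflection

/-- `T` is the reflection in a hyperplane of `ℝⁿ`. -/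
def IsReflection {n : ℕ} (T : Orth n) : Prop := ∃ τ : Euc n, τ ≠ 0 ∧ T = R τ

/-- The set of all reflections belonging to `W`. -/
def reflections {n : ℕ} (W : Subgroup (Orth n)) : Set (Orth n) := {T | T ∈ W ∧ IsReflection T}

/-- `W` is an irreducible finite real reflection group of rank `n` acting on `ℝⁿ`. -/
structure IsIrreducibleReflectionGroup {n : ℕ} (W : Subgroup (Orth n)) : Prop where
  finite : Finite W
  generated : Subgroup.closure (reflections W) = W
  rank_pos : 0 < n
  /-- The rank is `n`: no nonzero vector is fixed by all of `W`. -/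
  essential : ∀ v : Euc n, (∀ w ∈ W, w v = v) → v = 0
  /-- The only `W`-invariant subspaces are the trivial ones. -/
  irreducible : ∀ U : Submodule ℝ (Euc n), (∀ w ∈ W, ∀ v ∈ U, w v ∈ U) → U = ⊥ ∨ U = ⊤

/-- The complement of the union of the reflecting hyperplanes of `W`. -/
def hyperplaneComplement {n : ℕ} (W : Subgroup (Orth n)) : Set (Euc n) :=
  {x | ∀ τ : Euc n, τ ≠ 0 → R τ ∈ W → inner ℝ τ x ≠ 0}

/-- A (fundamental) chamber for `W`: a connected component of the complement of the union of
the reflecting hyperplanes. -/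
def IsChamber {n : ℕ} (W : Subgroup (Orth n)) (C : Set (Euc n)) : Prop :=
  ∃ x ∈ hyperplaneComplement W, C = connectedComponentIn (hyperplaneComplement W) x

/-- `ℓ(w)`, the total reflection length on `W`: the least number of reflections of `W` whose
product is `w` (so `ℓ(1) = 0`). It is used for `w ∈ W` only. -/
noncomputable def reflLength {n : ℕ} (W : Subgroup (Orth n)) (w : Orth n) : ℕ :=
  sInf {k | ∃ l : List (Orth n), (∀ T ∈ l, T ∈ reflections W) ∧ l.prod = w ∧ l.length = k}

/-- An irreducible finite real reflection group with a fundamental chamber `C`, the inward unit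
normals `α₁, …, αₙ` of `C` (indexed from `0` here), and a number `s` such that
`S₁ = {α₁, …, α_s}` and `S₂ = {α_{s+1}, …, αₙ}` are orthonormal sets. -/
structure Setting (n : ℕ) where
  W : Subgroup (Orth n)
  isIrreducible : IsIrreducibleReflectionGroup W
  C : Set (Euc n)
  isChamber : IsChamber W C
  α : Fin n → Euc n
  norm_α : ∀ i, ‖α i‖ = 1
  R_α_mem : ∀ i, R (α i) ∈ W
  C_eq : C = {x | ∀ i, 0 < inner ℝ (α i) x}
  s : ℕ
  s_le : s ≤ n
  orthogonal_S₁ : ∀ i j : Fin n, i.val < s → j.val < s → i ≠ j → inner ℝ (α i) (α j) = 0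
  orthogonal_S₂ : ∀ i j : Fin n, s ≤ i.val → s ≤ j.val → i ≠ j → inner ℝ (α i) (α j) = 0

namespace Setting

variable {n : ℕ} (D : Setting n)

/-- The bipartite Coxeter element `c = R₁ R₂ ⋯ Rₙ`. -/
noncomputable def c : Orth n := ((List.finRange n).map fun i => R (D.α i)).prod

/-- `c₊ = R(α₁) ⋯ R(α_s)`. -/
noncomputable def cPlus : Orth n := (((List.finRange n).take D.s).map fun i => R (D.α i)).prod

/-- The Coxeter number `h`, the order of `c`. -/
noncomputable def h : ℕ := orderOf D.c

/-- `α_{m+1}`, the index being read cyclically modulo `n`. -/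
noncomputable def alphaCyc (m : ℕ) : Euc n :=
  D.α ⟨m % n, Nat.mod_lt m D.isIrreducible.rank_pos⟩

/-- `ρ_{m+1} = R₁ R₂ ⋯ R_m (α_{m+1})` for `m ≥ 0`, indices read cyclically modulo `n`. -/
noncomputable def rhoSucc (m : ℕ) : Euc n :=
  ((List.range m).map fun j => R (D.alphaCyc j)).prod (D.alphaCyc m)

/-- The root `ρ_i` for `i ∈ ℤ`, where `ρ_{-k} = ρ_{nh-k}` for `k ≥ 0` (used for `k < nh`). -/
noncomputable def rho (i : ℤ) : Euc n :=
  if 0 < i then D.rhoSucc (i - 1).toNat else D.rhoSucc ((n * D.h : ℕ) + i - 1).toNat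

open Classical in
/-- The set of roots `{ρ_i : i ∈ l}`. -/
noncomputable def rootSet (l : List ℤ) : Finset (Euc n) := (l.map D.rho).toFinset

/-- For `l = [i₁, …, i_k]` and `τ_j = ρ_{i_j}`: the number `ℓ(R(τ₁) ⋯ R(τ_k) c)`. -/
noncomputable def len (l : List ℤ) : ℕ :=
  reflLength D.W ((l.map fun i => R (D.rho i)).prod * D.c)

/-! ### Facts needed to see that the faces of `EX(c)` are closed under passing to subsets -/

theorem R_apply (τ x : Euc n) :
    R τ x = x - (2 * (inner ℝ τ x / (‖τ‖ ^ 2))) • τ := by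
  have h1 := Submodule.reflection_orthogonal_apply (K := Submodule.span ℝ {τ}) x
  have h2 := Submodule.reflection_singleton_apply (𝕜 := ℝ) τ x
  unfold R
  rw [h1, h2, mul_smul, two_smul, two_smul]
  simp

theorem R_mul_self (τ : Euc n) : R τ * R τ = 1 :=
  Submodule.reflection_mul_reflection _

theorem R_fix (τ x : Euc n) (hx : inner ℝ τ x = 0) : R τ x = x := by
  apply Submodule.reflection_mem_subspace_eq_self
  exact Submodule.mem_orthogonal_singleton_iff_inner_right.2 hx

theorem conj_R (g : Orth n) (τ : Euc n) : g * R τ * g⁻¹ = R (g τ) := by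
  ext1 x
  have e : inner ℝ τ (g⁻¹ x) = inner ℝ (g τ) x := by
    rw [← g.inner_map_map τ (g⁻¹ x)]
    congr 1
    exact g.apply_symm_apply x
  have e2 : g (g⁻¹ x) = x := g.apply_symm_apply x
  change g (R τ (g⁻¹ x)) = _
  rw [R_apply, R_apply, map_sub, map_smul, e, e2, g.norm_map]

theorem conj_mem {W : Subgroup (Orth n)} {g T : Orth n} (hg : g ∈ W) (hT : T ∈ reflections W) :
    g * T * g⁻¹ ∈ reflections W := by
  obtain ⟨hTW, τ, hτ, rfl⟩ := hT
  exact ⟨W.mul_mem (W.mul_mem hg hTW) (W.inv_mem hg), g τ, by simpa using hτ, conj_R g τ⟩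

theorem mul_self_of_mem {W : Subgroup (Orth n)} {T : Orth n} (hT : T ∈ reflections W) :
    T * T = 1 := by
  obtain ⟨-, τ, -, rfl⟩ := hT
  exact R_mul_self τ

theorem prod_reverse {W : Subgroup (Orth n)} (l : List (Orth n))
    (hl : ∀ T ∈ l, T ∈ reflections W) : l.reverse.prod * l.prod = 1 := by
  induction l with
  | nil => simp
  | cons a l ih =>
    have ha := mul_self_of_mem (hl a (by simp))
    have := ih fun T hT => hl T (by simp [hT])
    calc (a :: l).reverse.prod * (a :: l).prod = l.reverse.prod * (a * a) * l.prod := by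
          simp [mul_assoc]
      _ = 1 := by rw [ha, mul_one, this]

theorem exists_list {W : Subgroup (Orth n)} (hW : Subgroup.closure (reflections W) = W)
    {w : Orth n} (hw : w ∈ W) :
    ∃ l : List (Orth n), (∀ T ∈ l, T ∈ reflections W) ∧ l.prod = w := by
  rw [← hW, ← Subgroup.mem_toSubmonoid, Subgroup.closure_toSubmonoid] at hw
  obtain ⟨l, hl, rfl⟩ := Submonoid.exists_list_of_mem_closure hw
  refine ⟨l, fun T hT => ?_, rfl⟩
  rcases hl T hT with h | h
  · exact h
  · have h2 := mul_self_of_mem h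
    have : T = T⁻¹ := by
      have h3 : T⁻¹ = T⁻¹⁻¹ := eq_inv_of_mul_eq_one_left h2
      rw [inv_inv] at h3
      exact h3.symm
    rw [this]; exact h

theorem sublist_prod {W : Subgroup (Orth n)} {l' l : List (Orth n)} (hs : l'.Sublist l)
    (hl : ∀ T ∈ l, T ∈ reflections W) :
    ∃ t : List (Orth n), (∀ T ∈ t, T ∈ reflections W) ∧ t.length + l'.length = l.length ∧
      l'.prod = t.prod * l.prod := by
  induction hs with
  | slnil => exact ⟨[], by simp⟩
  | @cons l₁ l₂ a _ ih =>
    obtain ⟨t, ht, h1, h2⟩ := ih fun T hT => hl T (by simp [hT])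
    have ha := hl a (by simp)
    refine ⟨t ++ [a], ?_, ?_, ?_⟩
    · intro T hT
      rcases List.mem_append.1 hT with h | h
      · exact ht T h
      · rw [List.mem_singleton.1 h]; exact ha
    · simp; omega
    · rw [h2]
      calc t.prod * l₂.prod = t.prod * (a * a) * l₂.prod := by
            rw [mul_self_of_mem ha, mul_one]
        _ = _ := by simp [mul_assoc]
  | @cons_cons l₁ l₂ a _ ih =>
    obtain ⟨t, ht, h1, h2⟩ := ih fun T hT => hl T (by simp [hT])
    have ha := hl a (by simp)
    refine ⟨t.map (MulAut.conj a), ?_, ?_, ?_⟩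
    · intro T hT
      obtain ⟨S, hS, rfl⟩ := List.mem_map.1 hT
      exact conj_mem ha.1 (ht S hS)
    · simp; omega
    · rw [← map_list_prod]
      simp [h2, mul_assoc]

theorem α_ne (i : Fin n) : D.α i ≠ 0 := by
  intro h
  have := D.norm_α i
  simp [h] at this

theorem span_α : Submodule.span ℝ (Set.range D.α) = ⊤ := by
  rw [← Submodule.orthogonal_eq_bot_iff, Submodule.eq_bot_iff]
  intro v hv
  have hv0 : ∀ i, inner ℝ (D.α i) v = 0 := fun i =>
    (Submodule.mem_orthogonal _ _).1 hv _ (Submodule.subset_span ⟨i, rfl⟩)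
  obtain ⟨x, hx, hC⟩ := D.isChamber
  have hxC : x ∈ D.C := by rw [hC]; exact mem_connectedComponentIn hx
  have key : ∀ T ∈ reflections D.W, T v = v := by
    rintro T ⟨hT, τ, hτ, rfl⟩
    apply R_fix
    by_contra hne
    have hy : x + (-(inner ℝ τ x / inner ℝ τ v)) • v ∈ D.C := by
      rw [D.C_eq] at hxC ⊢
      intro i
      rw [inner_add_right, inner_smul_right, hv0 i]
      simpa using hxC i
    rw [hC] at hy
    apply connectedComponentIn_subset _ _ hy τ hτ hT
    rw [inner_add_right, inner_smul_right]
    field_simp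
    ring
  apply D.isIrreducible.essential
  intro w hw
  obtain ⟨l, hl, rfl⟩ := exists_list D.isIrreducible.generated hw
  clear hw
  induction l with
  | nil => simp
  | cons a l ih =>
    rw [List.prod_cons]
    change a (l.prod v) = v
    rw [ih fun T hT => hl T (by simp [hT])]
    exact key a (hl a (by simp))

theorem linearIndependent_α : LinearIndependent ℝ D.α :=
  linearIndependent_of_top_le_span_of_card_eq_finrank D.span_α.ge (by simp)

theorem prod_sub_mem (l : List (Fin n)) (v : Euc n) :
    (l.map fun i => R (D.α i)).prod v - v ∈ Submodule.span ℝ (D.α '' {i | i ∈ l}) := by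
  induction l with
  | nil => simp
  | cons a l ih =>
    set w := (l.map fun i => R (D.α i)).prod v with hw
    have e : ((a :: l).map fun i => R (D.α i)).prod v = R (D.α a) w := by
      simp [hw]
    have h1 : w - v ∈ Submodule.span ℝ (D.α '' {i | i ∈ a :: l}) :=
      Submodule.span_mono (Set.image_mono fun i (hi : i ∈ l) => by simp [hi]) ih
    have h2 : D.α a ∈ Submodule.span ℝ (D.α '' {i | i ∈ a :: l}) :=
      Submodule.subset_span ⟨a, by simp, rfl⟩
    rw [e, R_apply, sub_right_comm]
    exact Submodule.sub_mem _ h1 (Submodule.smul_mem _ _ h2)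

theorem inner_eq_zero_of_fixed (l : List (Fin n)) (hl : l.Nodup) (v : Euc n)
    (hv : (l.map fun i => R (D.α i)).prod v = v) : ∀ i ∈ l, inner ℝ (D.α i) v = 0 := by
  induction l with
  | nil => simp
  | cons a l ih =>
    set w := (l.map fun i => R (D.α i)).prod v with hw
    have e : R (D.α a) w = v := by
      rw [← hv]; simp [hw]
    have e2 : w = R (D.α a) v := by
      have := Submodule.reflection_reflection (Submodule.span ℝ {D.α a})ᗮ w
      change R (D.α a) (R (D.α a) w) = w at this
      rw [← this, e]
    have hmem := D.prod_sub_mem l v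
    rw [← hw, e2, R_apply, sub_right_comm, sub_self, zero_sub,
      Submodule.neg_mem_iff, D.norm_α] at hmem
    have hnot : D.α a ∉ Submodule.span ℝ (D.α '' {i | i ∈ l}) :=
      D.linearIndependent_α.notMem_span_image (by simpa using (List.nodup_cons.1 hl).1)
    have h0 : inner ℝ (D.α a) v = 0 := by
      by_contra hne
      apply hnot
      refine (Submodule.smul_mem_iff _ ?_).1 hmem
      simpa using hne
    have hwv : w = v := by rw [e2, R_fix _ _ h0]
    intro i hi
    rcases List.mem_cons.1 hi with rfl | hi
    · exact h0
    · exact ih (List.nodup_cons.1 hl).2 hwv i hi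

theorem c_fixed (v : Euc n) (hv : D.c v = v) : v = 0 := by
  have h := D.inner_eq_zero_of_fixed (List.finRange n) (List.nodup_finRange n) v hv
  have hv' : v ∈ (Submodule.span ℝ (Set.range D.α))ᗮ := by
    rw [Submodule.mem_orthogonal]
    intro u hu
    induction hu using Submodule.span_induction with
    | mem x hx => obtain ⟨i, rfl⟩ := hx; exact h i (by simp)
    | zero => simp
    | add x y _ _ hx hy => rw [inner_add_left, hx, hy, add_zero]
    | smul a x _ hx => rw [inner_smul_left, hx, mul_zero]
  rw [D.span_α, Submodule.top_orthogonal_eq_bot] at hv'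
  simpa using hv'

theorem le_length (l : List (Orth n)) (hl : ∀ T ∈ l, T ∈ reflections D.W)
    (h : l.prod = D.c) : n ≤ l.length := by
  by_contra! hlt
  have hex : ∃ r : List (Euc n), r.length = l.length ∧ l = r.map R := by
    clear h hlt
    induction l with
    | nil => exact ⟨[], by simp⟩
    | cons a l ih =>
      obtain ⟨r, hr, hr'⟩ := ih fun T hT => hl T (by simp [hT])
      obtain ⟨-, τ, -, rfl⟩ := hl a (by simp)
      exact ⟨τ :: r, by simp [hr], by rw [hr']; simp⟩
  obtain ⟨r, hr, rfl⟩ := hex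
  classical
  have hfin : Module.finrank ℝ (Submodule.span ℝ (r.toFinset : Set (Euc n))) < n :=
    lt_of_le_of_lt ((finrank_span_finset_le_card _).trans (List.toFinset_card_le r))
      (hr ▸ hlt)
  have hne : (Submodule.span ℝ (r.toFinset : Set (Euc n)))ᗮ ≠ ⊥ := by
    intro hb
    rw [Submodule.orthogonal_eq_bot_iff] at hb
    rw [hb] at hfin
    simp at hfin
  obtain ⟨v, hv, hv0⟩ := Submodule.exists_mem_ne_zero_of_ne_bot hne
  apply hv0
  apply D.c_fixed
  have hτ : ∀ τ ∈ r, inner ℝ τ v = 0 := fun τ hτ =>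
    (Submodule.mem_orthogonal _ _).1 hv _ (Submodule.subset_span (by simpa using hτ))
  rw [← h]
  clear h hfin hne hv hr hlt hl
  induction r with
  | nil => simp
  | cons a r ih =>
    rw [List.map_cons, List.prod_cons]
    change R a ((r.map R).prod v) = v
    rw [ih fun τ h => hτ τ (by simp [h]), R_fix _ _ (hτ a (by simp))]

theorem c_mem : D.c ∈ D.W :=
  Subgroup.list_prod_mem _ fun T hT => by
    obtain ⟨i, -, rfl⟩ := List.mem_map.1 hT
    exact D.R_α_mem i

theorem R_rho_mem (i : ℤ) : R (D.rho i) ∈ reflections D.W := by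
  have key : ∀ m, R (D.rhoSucc m) ∈ reflections D.W := by
    intro m
    unfold rhoSucc
    have hα : D.alphaCyc m ≠ 0 := D.α_ne _
    rw [← conj_R]
    refine conj_mem (Subgroup.list_prod_mem _ fun T hT => ?_) ⟨D.R_α_mem _, _, hα, rfl⟩
    obtain ⟨i, -, rfl⟩ := List.mem_map.1 hT
    exact D.R_α_mem _
  unfold rho
  split_ifs <;> exact key _

theorem len_sublist {l' l : List ℤ} (hs : l'.Sublist l) (hl : D.len l + l.length = n) :
    D.len l' + l'.length = n := by
  have hmem : ∀ l : List ℤ, ∀ T ∈ l.map (fun i => R (D.rho i)), T ∈ reflections D.W := by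
    intro l T hT
    obtain ⟨i, -, rfl⟩ := List.mem_map.1 hT
    exact D.R_rho_mem i
  have hspec : ∀ l : List ℤ, ∃ m : List (Orth n), (∀ T ∈ m, T ∈ reflections D.W) ∧
      m.prod = (l.map fun i => R (D.rho i)).prod * D.c ∧ m.length = D.len l := by
    intro l
    have hne : {k | ∃ m : List (Orth n), (∀ T ∈ m, T ∈ reflections D.W) ∧
      m.prod = (l.map fun i => R (D.rho i)).prod * D.c ∧ m.length = k}.Nonempty := by
      obtain ⟨m, h1, h2⟩ := exists_list D.isIrreducible.generated
        (D.W.mul_mem (Subgroup.list_prod_mem _ fun T hT => (hmem l T hT).1) D.c_mem)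
      exact ⟨_, m, h1, h2, rfl⟩
    exact Nat.sInf_mem hne
  obtain ⟨m, hm, hmp, hml⟩ := hspec l
  obtain ⟨m', hm', hmp', hml'⟩ := hspec l'
  obtain ⟨t, ht, htl, htp⟩ := sublist_prod (hs.map fun i => R (D.rho i)) (hmem l)
  simp only [List.length_map] at htl
  have upper : D.len l' ≤ t.length + m.length := by
    refine Nat.sInf_le ⟨t ++ m, ?_, ?_, by simp⟩
    · intro T hT
      rcases List.mem_append.1 hT with h | h
      · exact ht T h
      · exact hm T h
    · rw [List.prod_append, hmp, htp, mul_assoc]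
  have lower : n ≤ l'.length + m'.length := by
    have := D.le_length ((l'.map fun i => R (D.rho i)).reverse ++ m') ?_ ?_
    · simpa using this
    · intro T hT
      rcases List.mem_append.1 hT with h | h
      · exact hmem l' T (List.mem_reverse.1 h)
      · exact hm' T h
    · rw [List.prod_append, hmp', ← mul_assoc, prod_reverse _ (hmem l'), one_mul]
  omega

/-! ### The complexes `EX(c)` and `AX(c)` -/

/-- The complex `EX(c)`: its (nonempty) simplices are the sets `{τ₁, …, τ_k}` of roots from the
list `ρ_{-n+s+1}, …, ρ_{nh/2+s}`, taken in the order `τ₁ < ⋯ < τ_k` of that list, that satisfy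
`ℓ(R(τ₁) ⋯ R(τ_k) c) = n - k`. -/
noncomputable def EX : PreAbstractSimplicialComplex (Euc n) where
  faces := {F | ∃ l : List ℤ, l ≠ [] ∧ l.Pairwise (· < ·) ∧
    (∀ i ∈ l, -(n : ℤ) + D.s + 1 ≤ i ∧ i ≤ ((n * D.h / 2 + D.s : ℕ) : ℤ)) ∧
    D.len l + l.length = n ∧ F = D.rootSet l}
  isRelLowerSet_faces := by
    rintro F ⟨l, hne, hsorted, hrange, hlen, rfl⟩
    refine ⟨by simpa [rootSet, List.toFinset_nonempty_iff] using hne, fun F' hF' hF'ne => ?_⟩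
    classical
    have hset : F' = D.rootSet (l.filter fun i => D.rho i ∈ F') := by
      ext x
      simp only [rootSet, List.mem_toFinset, List.mem_map, List.mem_filter, decide_eq_true_eq]
      constructor
      · intro hx
        have := hF' hx
        simp only [rootSet, List.mem_toFinset, List.mem_map] at this
        obtain ⟨i, hi, rfl⟩ := this
        exact ⟨i, ⟨hi, hx⟩, rfl⟩
      · rintro ⟨i, ⟨-, hi⟩, rfl⟩
        exact hi
    refine ⟨l.filter fun i => D.rho i ∈ F', ?_, hsorted.sublist List.filter_sublist,
      fun i hi => hrange i (List.mem_of_mem_filter hi),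
      D.len_sublist List.filter_sublist hlen, hset⟩
    intro h
    rw [h] at hset
    simp [rootSet] at hset
    simp [hset] at hF'ne

open Classical in
/-- The complex `AX(c) = c₊(EX(c))`, the image of `EX(c)` under the involution `c₊`. -/
noncomputable def AX : PreAbstractSimplicialComplex (Euc n) := D.EX.map D.cPlus

end Setting

/-- The vertex set of a complex: the points spanning a `0`-dimensional face. -/
def vertices {X : Type*} (K : PreAbstractSimplicialComplex X) : Set X := {x | {x} ∈ K.faces}

end BipartiteCoxeter

/-!
The involution `c₊` inverts `c` by conjugation, and it reverses the cyclic list of roots up to sign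
and up to a permutation inside blocks of orthogonal roots; both complexes are therefore described
by the same condition on lists of roots, read in opposite directions. Reflection length is invariant
under inversion and under conjugation by `W`, so `ℓ(R(τ₁) ⋯ R(τ_k) c)` does not change when each
`τᵢ` is replaced by `c₊ τᵢ` and the order is reversed (`Setting.reflLength_map_cPlus`).

The blocks are the translates of `S₁` and `c₊ S₂` under the powers of `c`; call them `B_j`, `j ∈ ℤ`,
in the order of the list. The vertices of `EX(c)` are the blocks `B_{-1}, …, B_h`, the list
`ρ₁, …, ρ_{nh/2+n}` is `B_0, …, B_{h+1}`, and what has to be shown is `c₊ B_j = B_{h-j}` together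
with the distinctness of the roots in `2h` consecutive blocks.

Both follow from the geometry of the Coxeter plane. A positive eigenvector of the Gram matrix of the
simple roots (`Setting.nonempty_perron`) with eigenvalue `1 - cos θ` yields two functionals `X`, `Y`,
nonnegative on positive roots, on which `c₊` and `c₋` act as two reflections of the plane whose
product `c` is the rotation by `2θ`; the map `(X, Y)` sends the roots of `B_j` to the ray at angle
`jθ` (`Setting.Perron.onRay_orbitRoot`). As no root has coordinates of opposite signs, `θ` divides `π`
(`Setting.Perron.exists_mul_θ_eq_pi`), and an exchange argument (`Setting.prod_eq_one_of_nonneg`)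
identifies `π / θ` with the order `h` of `c` (`Setting.Perron.h_eq`). The rays are thus distinct
modulo `2h`, and ray `j + h` is opposite to ray `j`. Finally, a root on the ray of `S₁` or `-S₂` is
an element of it, so `B_j` consists of all roots on its ray (`Setting.Perron.exists_orbitRoot`), and
`c₊`, which maps the `j`-th ray to the `(h - j)`-th one, maps `B_j` onto `B_{h-j}`. For odd `h` the
same argument with `-B_0 = B_h` gives `n = 2s` (`Setting.two_mul_s_of_odd`), which is what makes the
index bounds `nh/2 + s` and `nh/2 + n` fall on ends of blocks.
-/

namespace BipartiteCoxeter

/-! ### Reflections -/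

theorem R_neg {n : ℕ} (v : Euc n) : R (-v) = R v := by
  ext1 x
  rw [Setting.R_apply, Setting.R_apply, inner_neg_left, norm_neg, neg_div, mul_neg, neg_smul_neg]

theorem R_smul {n : ℕ} {a : ℝ} (ha : a ≠ 0) (v : Euc n) : R (a • v) = R v := by
  unfold R
  congr 2
  exact Submodule.span_singleton_smul_eq ha.isUnit v

theorem R_self {n : ℕ} (v : Euc n) : R v v = -v := by
  rcases eq_or_ne v 0 with rfl | h
  · simp
  · have : ‖v‖ ^ 2 ≠ 0 := by simpa using h
    rw [Setting.R_apply, real_inner_self_eq_norm_sq, div_self this, mul_one, two_smul]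
    abel

theorem R_apply_of_norm {n : ℕ} {v : Euc n} (hv : ‖v‖ = 1) (x : Euc n) :
    R v x = x - (2 * inner ℝ v x) • v := by
  rw [Setting.R_apply, hv, one_pow, div_one]

/-- Reflections in orthogonal vectors commute. -/
theorem commute_R {n : ℕ} {u v : Euc n} (h : inner ℝ u v = 0) : Commute (R u) (R v) := by
  have h1 := Setting.conj_R (R u) v
  rw [Setting.R_fix _ _ h] at h1
  exact mul_inv_eq_iff_eq_mul.1 h1

theorem prod_R_apply_of_orthonormal {n : ℕ} (l : List (Fin n)) (a : Fin n → Euc n)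
    (ha : ∀ i, ‖a i‖ = 1) (hl : l.Pairwise fun i j => inner ℝ (a i) (a j) = 0) (v : Euc n) :
    (l.map fun i => R (a i)).prod v = v - (l.map fun i => (2 * inner ℝ (a i) v) • a i).sum := by
  induction l with
  | nil => simp
  | cons i l ih =>
    rw [List.pairwise_cons] at hl
    have h0 : ∀ m : List (Fin n), (∀ j ∈ m, inner ℝ (a i) (a j) = 0) →
        inner ℝ (a i) ((m.map fun i => (2 * inner ℝ (a i) v) • a i).sum) = 0 := by
      intro m hm
      induction m with
      | nil => simp
      | cons j m ihm =>
        rw [List.map_cons, List.sum_cons, inner_add_right, inner_smul_right, hm j (by simp),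
          ihm fun k hk => hm k (by simp [hk])]
        simp
    rw [List.map_cons, List.prod_cons]
    change R (a i) ((l.map fun i => R (a i)).prod v) = _
    rw [ih hl.2, R_apply_of_norm (ha i), inner_sub_right, h0 l hl.1, List.map_cons, List.sum_cons,
      sub_zero]
    abel

namespace Setting

variable {n : ℕ} (D : Setting n)

/-! ### Roots and positivity -/

/-- The root system of `W`, normalised to unit vectors. -/
def IsRoot (v : Euc n) : Prop := ‖v‖ = 1 ∧ R v ∈ D.W

variable {D} in
theorem IsRoot.map {v : Euc n} (hv : D.IsRoot v) {w : Orth n} (hw : w ∈ D.W) :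
    D.IsRoot (w v) := by
  refine ⟨by rw [w.norm_map, hv.1], ?_⟩
  rw [← conj_R]
  exact D.W.mul_mem (D.W.mul_mem hw hv.2) (D.W.inv_mem hw)

variable {D} in
theorem IsRoot.neg {v : Euc n} (hv : D.IsRoot v) : D.IsRoot (-v) :=
  ⟨by rw [norm_neg, hv.1], by rw [R_neg]; exact hv.2⟩

theorem isRoot_α (i : Fin n) : D.IsRoot (D.α i) := ⟨D.norm_α i, D.R_α_mem i⟩

/-- The simple roots as a basis of `ℝⁿ`. -/
noncomputable def base : Module.Basis (Fin n) ℝ (Euc n) :=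
  Module.Basis.mk D.linearIndependent_α D.span_α.ge

/-- The coefficient of `αᵢ` in the expansion of a vector in the simple roots. -/
noncomputable def coef (i : Fin n) : Euc n →ₗ[ℝ] ℝ := D.base.coord i

theorem sum_coef (v : Euc n) : ∑ i, D.coef i v • D.α i = v := by
  simpa [base, coef] using D.base.sum_repr v

theorem coef_α (i j : Fin n) : D.coef i (D.α j) = if j = i then 1 else 0 := by
  have : D.α j = D.base j := by simp [base]
  rw [this, coef, Module.Basis.coord_apply, Module.Basis.repr_self, Finsupp.single_apply]

theorem coef_sum (x : Fin n → ℝ) (i : Fin n) : D.coef i (∑ j, x j • D.α j) = x i := by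
  simp [coef_α]

theorem ext_coef {u v : Euc n} (h : ∀ i, D.coef i u = D.coef i v) : u = v := by
  rw [← D.sum_coef u, ← D.sum_coef v]
  simp [h]

theorem inner_eq_sum_coef (u v : Euc n) :
    inner ℝ u v = ∑ i, D.coef i u * inner ℝ (D.α i) v := by
  conv_lhs => rw [← D.sum_coef u]
  simp [sum_inner, inner_smul_left]

theorem exists_mem_C : ∃ p, p ∈ D.C := by
  obtain ⟨x, hx, hC⟩ := D.isChamber
  exact ⟨x, by rw [hC]; exact mem_connectedComponentIn hx⟩

theorem inner_ne_zero_of_mem_C {v x : Euc n} (hv : D.IsRoot v) (hx : x ∈ D.C) :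
    inner ℝ v x ≠ 0 := by
  obtain ⟨y, -, hC⟩ := D.isChamber
  rw [hC] at hx
  exact connectedComponentIn_subset _ _ hx v (by rintro rfl; simpa using hv.1) hv.2

theorem convex_C {x y : Euc n} (hx : x ∈ D.C) (hy : y ∈ D.C) {a b : ℝ} (ha : 0 < a) (hb : 0 < b) :
    a • x + b • y ∈ D.C := by
  rw [D.C_eq] at hx hy ⊢
  intro i
  rw [inner_add_right, inner_smul_right, inner_smul_right]
  have := hx i
  have := hy i
  positivity

/-- A root that is positive at one point of the chamber is a nonnegative combination of the simple
roots: it is positive on the whole chamber, whose closure contains the dual basis. -/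
theorem coef_nonneg_of_inner_pos {v p : Euc n} (hv : D.IsRoot v) (hp : p ∈ D.C)
    (h : 0 < inner ℝ v p) (i : Fin n) : 0 ≤ D.coef i v := by
  have hpos : ∀ x ∈ D.C, 0 < inner ℝ v x := by
    intro x hx
    by_contra! hle
    have hlt := lt_of_le_of_ne hle (D.inner_ne_zero_of_mem_C hv hx)
    apply D.inner_ne_zero_of_mem_C hv (D.convex_C hp hx (neg_pos.2 hlt) h)
    rw [inner_add_right, inner_smul_right, inner_smul_right]
    ring
  set ω : Euc n := (InnerProductSpace.toDual ℝ (Euc n)).symm (D.coef i).toContinuousLinearMap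
  have hω : ∀ u, inner ℝ u ω = D.coef i u := by
    intro u
    rw [real_inner_comm, InnerProductSpace.toDual_symm_apply]
    rfl
  by_contra! hneg
  have hmem : ω + (-D.coef i v / inner ℝ v p) • p ∈ D.C := by
    have hp' := hp
    rw [D.C_eq] at hp' ⊢
    intro j
    rw [inner_add_right, inner_smul_right, hω, coef_α]
    have h1 := hp' j
    have h2 : 0 < -D.coef i v / inner ℝ v p := div_pos (neg_pos.2 hneg) h
    have h3 := mul_pos h2 h1
    split_ifs <;> linarith
  have := hpos _ hmem
  rw [inner_add_right, inner_smul_right, hω, div_mul_cancel₀ _ h.ne'] at this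
  linarith

/-- Every root is a nonnegative or a nonpositive combination of the simple roots. -/
theorem coef_sign {v : Euc n} (hv : D.IsRoot v) :
    (∀ i, 0 ≤ D.coef i v) ∨ ∀ i, D.coef i v ≤ 0 := by
  obtain ⟨p, hp⟩ := D.exists_mem_C
  rcases lt_or_gt_of_ne (D.inner_ne_zero_of_mem_C hv hp) with h | h
  · right
    intro i
    have := D.coef_nonneg_of_inner_pos hv.neg hp (by rwa [inner_neg_left, neg_pos]) i
    rw [map_neg] at this
    linarith
  · exact Or.inl (D.coef_nonneg_of_inner_pos hv hp h)

theorem coef_nonneg_of_pos {v : Euc n} (hv : D.IsRoot v) {j : Fin n} (hj : 0 < D.coef j v)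
    (i : Fin n) : 0 ≤ D.coef i v :=
  (D.coef_sign hv).elim (fun h => h i) fun h => absurd (h j) (not_le.2 hj)

theorem coef_R_α (i j : Fin n) (v : Euc n) :
    D.coef j (R (D.α i) v) = D.coef j v - if i = j then 2 * inner ℝ (D.α i) v else 0 := by
  rw [R_apply_of_norm (D.norm_α i), map_sub, map_smul, coef_α, smul_eq_mul]
  split_ifs <;> simp

theorem inner_α_nonpos {i j : Fin n} (hij : i ≠ j) : inner ℝ (D.α i) (D.α j) ≤ 0 := by
  have h := (D.isRoot_α j).map (D.R_α_mem i)
  have hj : 0 < D.coef j (R (D.α i) (D.α j)) := by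
    rw [coef_R_α, coef_α]
    simp [hij]
  have hi := D.coef_nonneg_of_pos h hj i
  rw [coef_R_α, coef_α] at hi
  simp [hij.symm] at hi
  linarith

/-- A root that is a nonnegative multiple of a simple root is equal to it. -/
theorem eq_α_of_coef {v : Euc n} (hv : D.IsRoot v) {i : Fin n} (hi : 0 ≤ D.coef i v)
    (h : ∀ j, j ≠ i → D.coef j v = 0) : v = D.α i := by
  have h1 : v = D.coef i v • D.α i := by
    conv_lhs => rw [← D.sum_coef v]
    exact Finset.sum_eq_single i (fun j _ hj => by rw [h j hj, zero_smul]) (by simp)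
  have h2 := hv.1
  rw [h1, norm_smul, D.norm_α, mul_one, Real.norm_of_nonneg hi] at h2
  rw [h1, h2, one_smul]

/-- A simple reflection makes no positive root negative except its own simple root. -/
theorem coef_R_α_nonneg {v : Euc n} (hv : D.IsRoot v) (h0 : ∀ j, 0 ≤ D.coef j v) (i : Fin n) :
    v = D.α i ∨ ∀ j, 0 ≤ D.coef j (R (D.α i) v) := by
  by_cases h : ∀ j, j ≠ i → D.coef j v = 0
  · exact Or.inl (D.eq_α_of_coef hv (h0 i) h)
  · right
    push Not at h
    obtain ⟨j, hji, hj⟩ := h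
    apply D.coef_nonneg_of_pos (hv.map (D.R_α_mem i)) (j := j)
    rw [coef_R_α, if_neg hji.symm, sub_zero]
    exact lt_of_le_of_ne (h0 j) hj.symm

theorem not_nonneg_and_nonpos {v : Euc n} (hv : D.IsRoot v) (h1 : ∀ j, 0 ≤ D.coef j v)
    (h2 : ∀ j, D.coef j v ≤ 0) : False := by
  have : v = 0 := D.ext_coef fun i => by rw [map_zero]; exact le_antisymm (h2 i) (h1 i)
  have h := hv.1
  simp [this] at h

theorem prod_R_mem (l : List (Fin n)) : (l.map fun i => R (D.α i)).prod ∈ D.W :=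
  Subgroup.list_prod_mem _ fun T hT => by
    obtain ⟨i, -, rfl⟩ := List.mem_map.1 hT
    exact D.R_α_mem i

/-- If a product of simple reflections makes a simple root negative, one of the factors is applied
to its own simple root. -/
theorem exists_split_of_nonpos (l : List (Fin n)) (k : Fin n)
    (h : ∀ j, D.coef j ((l.map fun i => R (D.α i)).prod (D.α k)) ≤ 0) :
    ∃ l₁ i l₂, l = l₁ ++ i :: l₂ ∧ (l₂.map fun i => R (D.α i)).prod (D.α k) = D.α i := by
  induction l with
  | nil =>
    have := h k
    simp [coef_α] at this
    linarith
  | cons i l ih =>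
    have hr := (D.isRoot_α k).map (D.prod_R_mem l)
    rcases D.coef_sign hr with hs | hs
    · rcases D.coef_R_α_nonneg hr hs i with he | he
      · exact ⟨[], i, l, rfl, he⟩
      · exact (D.not_nonneg_and_nonpos (hr.map (D.R_α_mem i)) he h).elim
    · obtain ⟨l₁, j, l₂, rfl, he⟩ := ih hs
      exact ⟨i :: l₁, j, l₂, rfl, he⟩

/-- The exchange argument: a product of simple reflections that maps all simple roots to positive
roots is the identity. -/
theorem prod_eq_one_of_nonneg (l : List (Fin n))
    (h : ∀ i j, 0 ≤ D.coef j ((l.map fun i => R (D.α i)).prod (D.α i))) :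
    (l.map fun i => R (D.α i)).prod = 1 := by
  induction hN : l.length using Nat.strong_induction_on generalizing l with
  | _ N ih =>
    rcases List.eq_nil_or_concat l with rfl | ⟨l', k, rfl⟩
    · simp
    · have h1 : ∀ j, D.coef j ((l'.map fun i => R (D.α i)).prod (D.α k)) ≤ 0 := by
        intro j
        have := h k j
        rw [List.concat_eq_append, List.map_append, List.prod_append] at this
        simp only [List.map_cons, List.map_nil, List.prod_cons, List.prod_nil, mul_one] at this
        change 0 ≤ D.coef j ((l'.map fun i => R (D.α i)).prod (R (D.α k) (D.α k))) at this
        rw [R_self, map_neg, map_neg] at this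
        linarith
      obtain ⟨l₁, i, l₂, rfl, he⟩ := D.exists_split_of_nonpos l' k h1
      have h2 := conj_R (l₂.map fun i => R (D.α i)).prod (D.α k)
      rw [he] at h2
      have h3 : (((l₁ ++ i :: l₂).concat k).map fun i => R (D.α i)).prod
          = ((l₁ ++ l₂).map fun i => R (D.α i)).prod := by
        simp only [List.concat_eq_append, List.map_append, List.prod_append, List.map_cons,
          List.prod_cons, List.map_nil, List.prod_nil, mul_one, ← h2]
        have := R_mul_self (D.α k)
        simp only [mul_assoc, inv_mul_cancel_left, this, mul_one]
      rw [h3] at h ⊢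
      exact ih _ (by simp at hN ⊢; omega) _ h rfl

/-! ### Irreducibility -/

theorem finite_isRoot : {v | D.IsRoot v}.Finite := by
  have := D.isIrreducible.finite
  refine Set.Finite.of_finite_fibers R ((Set.toFinite (D.W : Set (Orth n))).subset ?_) ?_
  · rintro _ ⟨v, hv, rfl⟩
    exact hv.2
  · rintro _ ⟨u, hu, rfl⟩
    refine (Set.toFinite {u, -u}).subset ?_
    rintro v ⟨hv, hvu : R v = R u⟩
    have h1 := R_self v
    rw [hvu, R_apply_of_norm hu.1] at h1
    have h2 : v = inner ℝ u v • u := by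
      have : (2 : ℝ) • v = (2 : ℝ) • (inner ℝ u v • u) := by
        rw [smul_smul, two_smul]
        nth_rewrite 2 [← neg_neg v]
        rw [← h1]
        abel
      exact smul_right_injective _ (two_ne_zero) this
    have h3 := hv.1
    rw [h2, norm_smul, hu.1, mul_one, Real.norm_eq_abs] at h3
    rcases eq_or_eq_neg_of_abs_eq h3 with h | h
    · left; rw [h2, h, one_smul]
    · right; rw [h2, h, neg_smul, one_smul]; rfl

/-- If the simple roots split into two orthogonal sets, every root is supported in one of them.
Among the roots with the same part `a ≠ 0` in the first set, the one of least height has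
nonpositive product with the second set, so its part there vanishes; comparing lengths, all of these
roots are equal to `a`. -/
theorem coef_eq_zero_of_split (Z : Finset (Fin n))
    (hZ : ∀ i ∈ Z, ∀ j ∉ Z, inner ℝ (D.α i) (D.α j) = 0) {v : Euc n} (hv : D.IsRoot v)
    {i : Fin n} (hi : i ∈ Z) (hiv : 0 < D.coef i v) : ∀ j ∉ Z, D.coef j v = 0 := by
  classical
  set a : Euc n := ∑ k ∈ Z, D.coef k v • D.α k with ha
  have hdec : ∀ u, (∀ k ∈ Z, D.coef k u = D.coef k v) →
      u = a + ∑ k ∈ Zᶜ, D.coef k u • D.α k := by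
    intro u hu
    conv_lhs => rw [← D.sum_coef u, ← Finset.sum_add_sum_compl Z]
    rw [ha, Finset.sum_congr rfl fun k hk => by rw [hu k hk]]
  have horth : ∀ y : Fin n → ℝ, inner ℝ a (∑ k ∈ Zᶜ, y k • D.α k) = 0 := by
    intro y
    rw [ha, sum_inner]
    refine Finset.sum_eq_zero fun k hk => ?_
    rw [inner_sum]
    refine Finset.sum_eq_zero fun j hj => ?_
    rw [inner_smul_left, inner_smul_right, hZ k hk j (by simpa using hj)]
    simp
  set S : Set (Euc n) := {u | D.IsRoot u ∧ ∀ k ∈ Z, D.coef k u = D.coef k v}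
  have hS : S.Finite := D.finite_isRoot.subset fun u hu => hu.1
  obtain ⟨u, hu, hmin⟩ := hS.exists_minimalFor (fun u => ∑ k, D.coef k u) _ ⟨v, hv, fun _ _ => rfl⟩
  set b : Euc n := ∑ k ∈ Zᶜ, D.coef k u • D.α k with hb
  have hub := hdec u hu.2
  have hu0 : ∀ k, 0 ≤ D.coef k u := D.coef_nonneg_of_pos hu.1 (j := i) (by rwa [hu.2 i hi])
  have hle : ∀ j ∉ Z, inner ℝ (D.α j) u ≤ 0 := by
    intro j hj
    by_contra! hlt
    have hsum : ∑ k, D.coef k (R (D.α j) u) = ∑ k, D.coef k u - 2 * inner ℝ (D.α j) u := by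
      simp [coef_R_α, Finset.sum_sub_distrib]
    have := hmin (j := R (D.α j) u) ⟨hu.1.map (D.R_α_mem j), fun k hk => by
      rw [coef_R_α, if_neg (by rintro rfl; exact hj hk), sub_zero, hu.2 k hk]⟩
      (by simp only [hsum]; linarith)
    simp only [hsum] at this
    linarith
  have hb0 : b = 0 := by
    have h1 : inner ℝ b b ≤ 0 := by
      have h2 : inner ℝ b b = inner ℝ b u := by
        conv_rhs => rw [hub, ← hb, inner_add_right, real_inner_comm, hb, horth, zero_add]
      rw [h2, hb, sum_inner]
      refine Finset.sum_nonpos fun k hk => ?_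
      rw [inner_smul_left]
      exact mul_nonpos_of_nonneg_of_nonpos (hu0 k) (hle k (by simpa using hk))
    exact real_inner_self_nonpos.1 h1
  have hnorm : ∀ y : Fin n → ℝ, ‖a + ∑ k ∈ Zᶜ, y k • D.α k‖ ^ 2
      = ‖a‖ ^ 2 + ‖∑ k ∈ Zᶜ, y k • D.α k‖ ^ 2 := by
    intro y
    rw [norm_add_sq_real, horth]
    ring
  have hvb : ∑ k ∈ Zᶜ, D.coef k v • D.α k = 0 := by
    have h1 := hnorm fun k => D.coef k u
    have h2 := hnorm fun k => D.coef k v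
    rw [← hub, hu.1.1, ← hb, hb0] at h1
    rw [← hdec v fun _ _ => rfl, hv.1] at h2
    have h3 : ‖∑ k ∈ Zᶜ, D.coef k v • D.α k‖ ^ 2 = 0 := by
      rw [norm_zero] at h1
      linarith
    simpa using h3
  intro j hj
  have hva : v = a := by
    have := hdec v fun _ _ => rfl
    rwa [hvb, add_zero] at this
  rw [hva, ha, map_sum]
  refine Finset.sum_eq_zero fun k hk => ?_
  rw [map_smul, coef_α, if_neg (by rintro rfl; exact hj hk), smul_zero]

/-- The Coxeter diagram is connected. -/
theorem not_split (Z : Finset (Fin n)) {i₀ j₀ : Fin n} (hi₀ : i₀ ∈ Z) (hj₀ : j₀ ∉ Z) :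
    ∃ i ∈ Z, ∃ j ∉ Z, inner ℝ (D.α i) (D.α j) ≠ 0 := by
  by_contra! hZ
  set U : Submodule ℝ (Euc n) := Submodule.span ℝ (D.α '' {j | j ∉ Z}) with hU
  have hinner : ∀ i ∈ Z, ∀ u ∈ U, inner ℝ (D.α i) u = 0 := by
    intro i hi u hu
    induction hu using Submodule.span_induction with
    | mem x hx => obtain ⟨j, hj, rfl⟩ := hx; exact hZ i hi j hj
    | zero => simp
    | add x y _ _ hx hy => rw [inner_add_right, hx, hy, add_zero]
    | smul r x _ hx => rw [inner_smul_right, hx, mul_zero]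
  have hroot : ∀ v, D.IsRoot v → v ∈ U ∨ ∀ u ∈ U, inner ℝ v u = 0 := by
    intro v hv
    by_cases h : ∀ i ∈ Z, D.coef i v = 0
    · left
      rw [← D.sum_coef v]
      refine Submodule.sum_mem _ fun i _ => ?_
      by_cases hi : i ∈ Z
      · rw [h i hi, zero_smul]
        exact U.zero_mem
      · exact U.smul_mem _ (Submodule.subset_span ⟨i, hi, rfl⟩)
    · right
      push Not at h
      obtain ⟨i, hi, hiv⟩ := h
      have h0 : ∀ j ∉ Z, D.coef j v = 0 := by
        rcases lt_or_gt_of_ne hiv with hlt | hlt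
        · intro j hj
          have := D.coef_eq_zero_of_split Z hZ hv.neg hi (by rw [map_neg]; linarith) j hj
          simpa using this
        · exact D.coef_eq_zero_of_split Z hZ hv hi hlt
      intro u hu
      rw [D.inner_eq_sum_coef]
      refine Finset.sum_eq_zero fun j _ => ?_
      by_cases hj : j ∈ Z
      · rw [hinner j hj u hu, mul_zero]
      · rw [h0 j hj, zero_mul]
  have hrefl : ∀ T ∈ reflections D.W, ∀ u ∈ U, T u ∈ U := by
    rintro T ⟨hT, τ, hτ, rfl⟩ u hu
    have hn : ‖τ‖⁻¹ ≠ 0 := by simpa using hτ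
    have hr : D.IsRoot (‖τ‖⁻¹ • τ) := by
      refine ⟨by rw [norm_smul, norm_inv, norm_norm]; exact inv_mul_cancel₀ (by simpa using hτ), ?_⟩
      rwa [R_smul hn]
    rw [← R_smul hn]
    rcases hroot _ hr with h | h
    · rw [R_apply_of_norm hr.1]
      exact U.sub_mem hu (U.smul_mem _ h)
    · rwa [R_fix _ _ (h u hu)]
  have hinv : ∀ w ∈ D.W, ∀ v ∈ U, w v ∈ U := by
    intro w hw
    obtain ⟨l, hl, rfl⟩ := exists_list D.isIrreducible.generated hw
    clear hw
    induction l with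
    | nil => simp
    | cons T l ih =>
      intro v hv
      exact hrefl T (hl T (by simp)) _ (ih (fun T hT => hl T (by simp [hT])) v hv)
  rcases D.isIrreducible.irreducible U hinv with h | h
  · apply D.α_ne j₀
    rw [← Submodule.mem_bot ℝ, ← h]
    exact Submodule.subset_span ⟨j₀, hj₀, rfl⟩
  · have := hinner i₀ hi₀ (D.α i₀) (by rw [h]; trivial)
    rw [real_inner_self_eq_norm_sq, D.norm_α] at this
    norm_num at this

/-! ### The Perron–Frobenius vector -/

/-- A positive eigenvector of the Gram matrix of the simple roots, the eigenvalue being written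
`1 - cos θ` with an acute or right angle `θ`. -/
structure Perron where
  x : Fin n → ℝ
  x_pos : ∀ i, 0 < x i
  θ : ℝ
  θ_pos : 0 < θ
  θ_le : θ ≤ Real.pi / 2
  eigen : ∀ i, ∑ j, x j * inner ℝ (D.α i) (D.α j) = (1 - Real.cos θ) * x i

/-- The map `y ↦ ∑ yᵢ αᵢ`. -/
noncomputable def synthesis : Euc n →L[ℝ] Euc n :=
  LinearMap.toContinuousLinearMap
    { toFun := fun y => ∑ i, y i • D.α i
      map_add' := fun y z => by simp [add_smul, Finset.sum_add_distrib]
      map_smul' := fun r y => by simp [mul_smul, Finset.smul_sum] }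

theorem synthesis_apply (y : Euc n) : D.synthesis y = ∑ i, y i • D.α i := rfl

/-- A minimiser `y` of `‖∑ yᵢ αᵢ‖` on the unit sphere is an eigenvector of the Gram matrix. It may
be replaced by its absolute value because the products of different simple roots are nonpositive,
and then it has no zero coordinate because the diagram is connected. -/
theorem nonempty_perron : Nonempty D.Perron := by
  have hn := D.isIrreducible.rank_pos
  set T : Euc n →L[ℝ] Euc n := ContinuousLinearMap.adjoint D.synthesis ∘L D.synthesis with hTdef
  have hTinner : ∀ y z, inner ℝ y (T z) = inner ℝ (D.synthesis y) (D.synthesis z) := by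
    intro y z
    rw [hTdef, ContinuousLinearMap.comp_apply, ContinuousLinearMap.adjoint_inner_right]
  have hT : IsSelfAdjoint T := by
    rw [ContinuousLinearMap.isSelfAdjoint_iff_isSymmetric]
    intro y z
    change inner ℝ (T y) z = inner ℝ y (T z)
    rw [real_inner_comm, hTinner, hTinner, real_inner_comm]
  have hQ : ∀ y, T.reApplyInnerSelf y
      = ∑ i, ∑ j, y i * y j * inner ℝ (D.α i) (D.α j) := by
    intro y
    rw [ContinuousLinearMap.reApplyInnerSelf_apply, RCLike.re_to_real, real_inner_comm, hTinner,
      synthesis_apply, sum_inner]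
    refine Finset.sum_congr rfl fun i _ => ?_
    rw [inner_sum]
    refine Finset.sum_congr rfl fun j _ => ?_
    rw [inner_smul_left, inner_smul_right]
    simp [mul_assoc]
  have hne : (Metric.sphere (0 : Euc n) 1).Nonempty :=
    ⟨D.α ⟨0, hn⟩, by simpa using D.norm_α _⟩
  obtain ⟨y, hy, hmin⟩ := (isCompact_sphere (0 : Euc n) 1).exists_isMinOn hne
    (T.reApplyInnerSelf_continuous.continuousOn)
  set z : Euc n := WithLp.toLp 2 fun i => |y i| with hz
  have hzi : ∀ i, z i = |y i| := fun i => rfl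
  have hz1 : ‖z‖ = 1 := by
    rw [mem_sphere_zero_iff_norm] at hy
    rw [← hy, EuclideanSpace.norm_eq, EuclideanSpace.norm_eq]
    simp [hzi]
  have hzy : T.reApplyInnerSelf z ≤ T.reApplyInnerSelf y := by
    rw [hQ, hQ]
    refine Finset.sum_le_sum fun i _ => Finset.sum_le_sum fun j _ => ?_
    rw [hzi, hzi]
    rcases eq_or_ne i j with rfl | hij
    · rw [abs_mul_abs_self]
    · rw [← abs_mul]
      exact mul_le_mul_of_nonpos_right (le_abs_self _) (D.inner_α_nonpos hij)
  have hz0 : z ≠ 0 := by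
    intro h
    rw [h, norm_zero] at hz1
    exact zero_ne_one hz1
  have hzmin : IsMinOn T.reApplyInnerSelf (Metric.sphere (0 : Euc n) ‖z‖) z := by
    rw [hz1]
    intro u hu
    exact hzy.trans (hmin hu)
  have heig := (hT.hasEigenvector_of_isMinOn hz0 hzmin).apply_eq_smul
  set μ : ℝ := ⨅ u : {u : Euc n // u ≠ 0}, T.rayleighQuotient u
  have heig' : T z = μ • z := heig
  have hG : ∀ i, ∑ j, z j * inner ℝ (D.α i) (D.α j) = μ * z i := by
    intro i
    have h1 := hTinner (EuclideanSpace.single i 1) z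
    rw [heig', inner_smul_right, EuclideanSpace.inner_single_left, synthesis_apply,
      synthesis_apply, inner_sum] at h1
    simp [inner_smul_right] at h1
    exact h1.symm
  have hznn : ∀ i, 0 ≤ z i := fun i => abs_nonneg _
  have hpos : ∀ i, 0 < z i := by
    by_contra! h
    obtain ⟨i₀, hi₀⟩ := h
    obtain ⟨j₀, hj₀⟩ : ∃ j, z j ≠ 0 := by
      by_contra! h
      exact hz0 (by ext i; simpa using h i)
    classical
    obtain ⟨i, hi, j, hj, hij⟩ := D.not_split (Finset.univ.filter fun i => z i = 0)
      (i₀ := i₀) (j₀ := j₀) (by simpa using le_antisymm hi₀ (hznn i₀)) (by simpa using hj₀)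
    simp only [Finset.mem_filter, Finset.mem_univ, true_and] at hi hj
    have hsum := hG i
    rw [hi, mul_zero, Finset.sum_eq_zero_iff_of_nonpos] at hsum
    · have := hsum j (Finset.mem_univ j)
      exact (mul_ne_zero hj hij) this
    · intro k _
      rcases eq_or_ne i k with rfl | hik
      · rw [hi, zero_mul]
      · exact mul_nonpos_of_nonneg_of_nonpos (hznn k) (D.inner_α_nonpos hik)
  have hμpos : 0 < μ := by
    have h1 := hTinner z z
    rw [heig', inner_smul_right, real_inner_self_eq_norm_sq, hz1, real_inner_self_eq_norm_sq] at h1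
    have h2 : D.synthesis z ≠ 0 := by
      intro h
      have h3 := D.coef_sum z ⟨0, hn⟩
      rw [← synthesis_apply, h, map_zero] at h3
      exact (hpos _).ne h3
    have h3 : 0 < ‖D.synthesis z‖ ^ 2 := by positivity
    linarith
  have hμle : μ ≤ 1 := by
    have h1 := hG ⟨0, hn⟩
    have h2 : ∑ j, z j * inner ℝ (D.α ⟨0, hn⟩) (D.α j) ≤ z ⟨0, hn⟩ := by
      rw [← Finset.add_sum_erase _ _ (Finset.mem_univ (⟨0, hn⟩ : Fin n)),
        real_inner_self_eq_norm_sq, D.norm_α]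
      have : ∑ j ∈ Finset.univ.erase (⟨0, hn⟩ : Fin n),
          z j * inner ℝ (D.α ⟨0, hn⟩) (D.α j) ≤ 0 :=
        Finset.sum_nonpos fun j hj => mul_nonpos_of_nonneg_of_nonpos (hznn j)
          (D.inner_α_nonpos (Finset.ne_of_mem_erase hj).symm)
      linarith
    rw [h1] at h2
    have := hpos ⟨0, hn⟩
    nlinarith
  refine ⟨⟨z, hpos, Real.arccos (1 - μ), Real.arccos_pos.2 (by linarith),
    Real.arccos_le_pi_div_two.2 (by linarith), fun i => ?_⟩⟩
  rw [Real.cos_arccos (by linarith) (by linarith), sub_sub_cancel]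
  exact hG i

/-! ### The bipartition -/

/-- The product `R(α_{s+1}) ⋯ R(αₙ)` of the second half of the simple reflections. -/
noncomputable def cMinus : Orth n := (((List.finRange n).drop D.s).map fun i => R (D.α i)).prod

theorem c_eq : D.c = D.cPlus * D.cMinus := by
  rw [c, cPlus, cMinus, ← List.prod_append, ← List.map_append, List.take_append_drop]

theorem mem_take_iff (i : Fin n) : i ∈ (List.finRange n).take D.s ↔ i.val < D.s := by
  rw [List.mem_take_iff_getElem]
  constructor
  · rintro ⟨k, hk, rfl⟩
    simp at hk ⊢
    exact hk.1
  · intro h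
    exact ⟨i, by simp [h], by simp⟩

theorem mem_drop_iff (i : Fin n) : i ∈ (List.finRange n).drop D.s ↔ ¬ i.val < D.s := by
  rw [List.mem_drop_iff_getElem]
  constructor
  · rintro ⟨k, hk, rfl⟩
    simp
  · intro h
    refine ⟨i - D.s, by simp; omega, ?_⟩
    ext
    simp
    omega

theorem prod_R_apply_of_nodup (p : Fin n → Prop) [DecidablePred p] (l : List (Fin n))
    (hl : l.Nodup) (hp : ∀ i, i ∈ l ↔ p i)
    (horth : ∀ i j, p i → p j → i ≠ j → inner ℝ (D.α i) (D.α j) = 0) (v : Euc n) :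
    (l.map fun i => R (D.α i)).prod v
      = v - ∑ i with p i, (2 * inner ℝ (D.α i) v) • D.α i := by
  rw [prod_R_apply_of_orthonormal l D.α D.norm_α]
  · rw [← List.sum_toFinset _ hl]
    congr 2
    ext i
    simp [hp]
  · exact hl.imp_of_mem fun {i j} hi hj hij => horth i j ((hp i).1 hi) ((hp j).1 hj) hij

theorem cPlus_apply (v : Euc n) :
    D.cPlus v = v - ∑ i with i.val < D.s, (2 * inner ℝ (D.α i) v) • D.α i :=
  D.prod_R_apply_of_nodup (fun i => i.val < D.s) _
    ((List.take_sublist _ _).nodup (List.nodup_finRange n)) D.mem_take_iff D.orthogonal_S₁ v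

theorem cMinus_apply (v : Euc n) :
    D.cMinus v = v - ∑ i with ¬ i.val < D.s, (2 * inner ℝ (D.α i) v) • D.α i :=
  D.prod_R_apply_of_nodup (fun i => ¬ i.val < D.s) _
    ((List.drop_sublist _ _).nodup (List.nodup_finRange n)) D.mem_drop_iff
    (fun i j hi hj => D.orthogonal_S₂ i j (not_lt.1 hi) (not_lt.1 hj)) v

theorem sum_two_inner_smul (p : Fin n → Prop) [DecidablePred p]
    (horth : ∀ i j, p i → p j → i ≠ j → inner ℝ (D.α i) (D.α j) = 0) {j : Fin n} (hj : p j) :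
    ∑ i with p i, (2 * inner ℝ (D.α i) (D.α j)) • D.α i = (2 : ℝ) • D.α j := by
  rw [Finset.sum_eq_single j]
  · rw [real_inner_self_eq_norm_sq, D.norm_α]
    norm_num
  · intro i hi hij
    rw [horth i j (by simpa using hi) hj hij]
    simp
  · intro h
    exact absurd (by simpa using hj) h

theorem cPlus_α {j : Fin n} (hj : j.val < D.s) : D.cPlus (D.α j) = -D.α j := by
  rw [cPlus_apply, D.sum_two_inner_smul (fun i => i.val < D.s) D.orthogonal_S₁ hj, two_smul]
  abel

theorem cMinus_α {j : Fin n} (hj : ¬ j.val < D.s) : D.cMinus (D.α j) = -D.α j := by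
  rw [cMinus_apply, D.sum_two_inner_smul (fun i => ¬ i.val < D.s)
    (fun i j hi hj => D.orthogonal_S₂ i j (not_lt.1 hi) (not_lt.1 hj)) hj, two_smul]
  abel

theorem cPlus_mem : D.cPlus ∈ D.W := D.prod_R_mem _

namespace Perron

variable {D} (P : D.Perron)

/-- The functional `∑ xᵢ · coefᵢ` over the simple roots that satisfy `p`, where `x` is the
Perron–Frobenius vector. -/
noncomputable def height (p : Fin n → Prop) [DecidablePred p] : Euc n →ₗ[ℝ] ℝ :=
  ∑ i with p i, P.x i • D.coef i

theorem height_apply (p : Fin n → Prop) [DecidablePred p] (v : Euc n) :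
    P.height p v = ∑ i with p i, P.x i * D.coef i v := by
  simp [height]

theorem height_α (p : Fin n → Prop) [DecidablePred p] (j : Fin n) :
    P.height p (D.α j) = if p j then P.x j else 0 := by
  simp [height_apply, coef_α]

section

variable (p q : Fin n → Prop) [DecidablePred p] [DecidablePred q] (hq : ∀ i, q i ↔ ¬ p i)
  (hporth : ∀ i j, p i → p j → i ≠ j → inner ℝ (D.α i) (D.α j) = 0)
  (hqorth : ∀ i j, q i → q j → i ≠ j → inner ℝ (D.α i) (D.α j) = 0)

include hq hporth hqorth in
theorem sum_x_mul_inner (v : Euc n) :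
    ∑ i with p i, P.x i * inner ℝ (D.α i) v = P.height p v - Real.cos P.θ * P.height q v := by
  have self : ∀ (r : Fin n → Prop) [DecidablePred r],
      (∀ i j, r i → r j → i ≠ j → inner ℝ (D.α i) (D.α j) = 0) → ∀ j, r j →
      ∑ i with r i, P.x i * inner ℝ (D.α i) (D.α j) = P.x j := by
    intro r _ hr j hj
    rw [Finset.sum_eq_single j]
    · rw [real_inner_self_eq_norm_sq, D.norm_α]
      norm_num
    · intro i hi hij
      rw [hr i j (by simpa using hi) hj hij, mul_zero]
    · intro h
      exact absurd (by simpa using hj) h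
  have key : ∀ j, ∑ i with p i, P.x i * inner ℝ (D.α i) (D.α j)
      = P.height p (D.α j) - Real.cos P.θ * P.height q (D.α j) := by
    intro j
    rw [height_α, height_α]
    by_cases hj : p j
    · rw [self p hporth j hj]
      simp [hq, hj]
    · have h1 := P.eigen j
      rw [← Finset.sum_filter_add_sum_filter_not _ p] at h1
      have h2 := self q hqorth j ((hq j).2 hj)
      have h3 : (Finset.univ.filter fun i => ¬ p i) = Finset.univ.filter q := by
        ext i; simp [hq]
      simp only [real_inner_comm] at h1 h2 ⊢
      rw [h3, h2] at h1
      simp [hq, hj]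
      linarith
  rw [← D.sum_coef v]
  simp only [map_sum, map_smul, inner_sum, inner_smul_right, Finset.mul_sum, smul_eq_mul]
  rw [Finset.sum_comm, ← Finset.sum_sub_distrib]
  refine Finset.sum_congr rfl fun j _ => ?_
  calc _ = D.coef j v * ∑ i with p i, P.x i * inner ℝ (D.α i) (D.α j) := by
        rw [Finset.mul_sum]
        exact Finset.sum_congr rfl fun i _ => by ring
    _ = _ := by rw [key]; ring

include hq hporth hqorth in
theorem height_reflect (v : Euc n) :
    P.height p (v - ∑ i with p i, (2 * inner ℝ (D.α i) v) • D.α i)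
      = -P.height p v + 2 * Real.cos P.θ * P.height q v := by
  have h1 : P.height p (∑ i with p i, (2 * inner ℝ (D.α i) v) • D.α i)
      = 2 * ∑ i with p i, P.x i * inner ℝ (D.α i) v := by
    rw [map_sum, Finset.mul_sum]
    refine Finset.sum_congr rfl fun i hi => ?_
    rw [map_smul, height_α, if_pos (by simpa using hi), smul_eq_mul]
    ring
  rw [map_sub, h1, P.sum_x_mul_inner p q hq hporth hqorth]
  ring

include hq in
theorem height_reflect_compl (v : Euc n) :
    P.height q (v - ∑ i with p i, (2 * inner ℝ (D.α i) v) • D.α i) = P.height q v := by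
  rw [map_sub, map_sum, Finset.sum_eq_zero, sub_zero]
  intro i hi
  rw [map_smul, height_α, if_neg (by simpa [hq] using hi), smul_zero]

end

/-- The part of the Perron–Frobenius functional that belongs to `S₁`. -/
noncomputable def X : Euc n →ₗ[ℝ] ℝ := P.height fun i => i.val < D.s

/-- The part of the Perron–Frobenius functional that belongs to `S₂`. -/
noncomputable def Y : Euc n →ₗ[ℝ] ℝ := P.height fun i => ¬ i.val < D.s

theorem orth₂ (i j : Fin n) (hi : ¬ i.val < D.s) (hj : ¬ j.val < D.s) (h : i ≠ j) :
    inner ℝ (D.α i) (D.α j) = 0 :=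
  D.orthogonal_S₂ i j (not_lt.1 hi) (not_lt.1 hj) h

theorem X_cPlus (v : Euc n) : P.X (D.cPlus v) = -P.X v + 2 * Real.cos P.θ * P.Y v := by
  rw [cPlus_apply]
  exact P.height_reflect _ _ (fun _ => Iff.rfl) D.orthogonal_S₁ orth₂ v

theorem Y_cPlus (v : Euc n) : P.Y (D.cPlus v) = P.Y v := by
  rw [cPlus_apply]
  exact P.height_reflect_compl _ _ (fun _ => Iff.rfl) v

theorem X_cMinus (v : Euc n) : P.X (D.cMinus v) = P.X v := by
  rw [cMinus_apply]
  exact P.height_reflect_compl _ _ (fun _ => not_not.symm) v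

theorem Y_cMinus (v : Euc n) : P.Y (D.cMinus v) = -P.Y v + 2 * Real.cos P.θ * P.X v := by
  rw [cMinus_apply]
  exact P.height_reflect _ _ (fun _ => not_not.symm) orth₂ D.orthogonal_S₁ v

end Perron

/-! ### The rays of the Coxeter plane -/

/-- The `k`-th translate under `c` of the root attached to `αᵢ`: of `αᵢ` itself if `αᵢ ∈ S₁`, and of
`c₊ αᵢ = -c αᵢ` if `αᵢ ∈ S₂`. -/
noncomputable def orbitRoot (k : ℤ) (i : Fin n) : Euc n :=
  if i.val < D.s then (D.c ^ k) (D.α i) else -(D.c ^ (k + 1)) (D.α i)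

/-- The number of the ray on which `D.orbitRoot k i` lies. -/
def ray (k : ℤ) (i : Fin n) : ℤ := if i.val < D.s then 2 * k else 2 * k + 1

theorem isRoot_orbitRoot (k : ℤ) (i : Fin n) : D.IsRoot (D.orbitRoot k i) := by
  unfold orbitRoot
  split_ifs
  · exact (D.isRoot_α i).map (D.W.zpow_mem D.c_mem _)
  · exact ((D.isRoot_α i).map (D.W.zpow_mem D.c_mem _)).neg

theorem c_zpow_zero_apply (v : Euc n) : (D.c ^ (0 : ℤ)) v = v := by
  rw [zpow_zero]
  rfl

theorem c_zpow_add_apply (k l : ℤ) (v : Euc n) : (D.c ^ (k + l)) v = (D.c ^ k) ((D.c ^ l) v) := by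
  rw [zpow_add]
  rfl

theorem c_zpow_orbitRoot (k l : ℤ) (i : Fin n) :
    (D.c ^ k) (D.orbitRoot l i) = D.orbitRoot (k + l) i := by
  unfold orbitRoot
  split_ifs
  · rw [c_zpow_add_apply]
  · rw [map_neg, add_assoc, c_zpow_add_apply D k]

namespace Perron

variable {D} (P : D.Perron)

/-- `v` is mapped by `(X, Y)` to a positive multiple of `(sin (j + 1)θ, sin jθ)`. With respect to two
unit vectors at angle `π - θ`, these are the coordinates of a vector at angle `jθ` from the first
one. -/
def OnRay (v : Euc n) (j : ℤ) : Prop :=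
  ∃ r : ℝ, 0 < r ∧ P.X v = r * Real.sin ((j + 1) * P.θ) ∧ P.Y v = r * Real.sin (j * P.θ)

theorem sin_recurrence (θ t : ℝ) :
    Real.sin ((t + 1) * θ) = 2 * Real.cos θ * Real.sin (t * θ) - Real.sin ((t - 1) * θ) := by
  rw [add_mul, sub_mul, one_mul, Real.sin_add, Real.sin_sub]
  ring

theorem OnRay.c {v : Euc n} {j : ℤ} (h : P.OnRay v j) : P.OnRay (D.c v) (j + 2) := by
  obtain ⟨r, hr, hX, hY⟩ := h
  have h1 := sin_recurrence P.θ (j + 1)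
  have h2 := sin_recurrence P.θ (j + 2)
  rw [add_sub_cancel_right] at h1
  rw [show (j : ℝ) + 2 - 1 = j + 1 by ring] at h2
  rw [show (j : ℝ) + 1 + 1 = j + 2 by ring] at h1
  refine ⟨r, hr, ?_, ?_⟩
  · rw [c_eq]
    change P.X (D.cPlus (D.cMinus v)) = _
    rw [X_cPlus, X_cMinus, Y_cMinus, hX, hY]
    push_cast
    rw [h2, h1]
    ring
  · rw [c_eq]
    change P.Y (D.cPlus (D.cMinus v)) = _
    rw [Y_cPlus, Y_cMinus, hX, hY]
    push_cast
    rw [h1]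
    ring

theorem OnRay.of_c {v : Euc n} {j : ℤ} (h : P.OnRay (D.c v) (j + 2)) : P.OnRay v j := by
  obtain ⟨r, hr, hX, hY⟩ := h
  have h1 := sin_recurrence P.θ (j + 1)
  have h2 := sin_recurrence P.θ (j + 2)
  rw [add_sub_cancel_right] at h1
  rw [show (j : ℝ) + 2 - 1 = j + 1 by ring] at h2
  rw [show (j : ℝ) + 1 + 1 = j + 2 by ring] at h1
  rw [c_eq] at hX hY
  change P.X (D.cPlus (D.cMinus v)) = _ at hX
  change P.Y (D.cPlus (D.cMinus v)) = _ at hY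
  rw [X_cPlus, X_cMinus, Y_cMinus] at hX
  rw [Y_cPlus, Y_cMinus] at hY
  push_cast at hX hY
  rw [h2] at hX
  refine ⟨r, hr, by linear_combination 2 * Real.cos P.θ * hY - hX, ?_⟩
  linear_combination 2 * Real.cos P.θ * (2 * Real.cos P.θ * hY - hX) - hY - r * h1

theorem onRay_c_iff {v : Euc n} {j : ℤ} : P.OnRay (D.c v) (j + 2) ↔ P.OnRay v j :=
  ⟨OnRay.of_c P, OnRay.c P⟩

theorem onRay_zpow_iff (k : ℤ) {v : Euc n} {j : ℤ} :
    P.OnRay ((D.c ^ k) v) (j + 2 * k) ↔ P.OnRay v j := by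
  have hadd : ∀ k : ℤ, (D.c ^ (k + 1)) v = D.c ((D.c ^ k) v) := by
    intro k
    rw [add_comm, c_zpow_add_apply, zpow_one]
  induction k using Int.induction_on with
  | zero => simp
  | succ k ih =>
    rw [hadd, mul_add, mul_one, ← add_assoc]
    exact P.onRay_c_iff.trans ih
  | pred k ih =>
    refine P.onRay_c_iff.symm.trans (Iff.trans (iff_of_eq ?_) ih)
    rw [← hadd, sub_add_cancel]
    congr 1
    ring

theorem sin_θ_pos : 0 < Real.sin P.θ := Real.sin_pos_of_pos_of_lt_pi P.θ_pos
  (lt_of_le_of_lt P.θ_le (half_lt_self Real.pi_pos))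

theorem onRay_α {i : Fin n} (hi : i.val < D.s) : P.OnRay (D.α i) 0 := by
  have hs := P.sin_θ_pos
  refine ⟨P.x i / Real.sin P.θ, div_pos (P.x_pos i) hs, ?_, ?_⟩
  · rw [X, height_α, if_pos hi]
    simp [hs.ne']
  · rw [Y, height_α, if_neg (not_not.2 hi)]
    simp

theorem onRay_neg_α {i : Fin n} (hi : ¬ i.val < D.s) : P.OnRay (-D.α i) (-1) := by
  have hs := P.sin_θ_pos
  refine ⟨P.x i / Real.sin P.θ, div_pos (P.x_pos i) hs, ?_, ?_⟩
  · rw [map_neg, X, height_α, if_neg hi]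
    simp
  · rw [map_neg, Y, height_α, if_pos hi]
    simp [hs.ne']

theorem onRay_orbitRoot (k : ℤ) (i : Fin n) : P.OnRay (D.orbitRoot k i) (D.ray k i) := by
  unfold orbitRoot ray
  split_ifs with hi
  · rw [← zero_add (2 * k), onRay_zpow_iff]
    exact P.onRay_α hi
  · rw [← map_neg, show 2 * k + 1 = -1 + 2 * (k + 1) by ring, onRay_zpow_iff]
    exact P.onRay_neg_α hi

theorem X_nonneg {v : Euc n} (h : ∀ i, 0 ≤ D.coef i v) : 0 ≤ P.X v := by
  rw [X, height_apply]
  exact Finset.sum_nonneg fun i _ => mul_nonneg (P.x_pos i).le (h i)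

theorem Y_nonneg {v : Euc n} (h : ∀ i, 0 ≤ D.coef i v) : 0 ≤ P.Y v := by
  rw [Y, height_apply]
  exact Finset.sum_nonneg fun i _ => mul_nonneg (P.x_pos i).le (h i)

/-- `X` and `Y` do not have opposite signs on a root. -/
theorem X_Y_sign {v : Euc n} (hv : D.IsRoot v) :
    (0 ≤ P.X v ∧ 0 ≤ P.Y v) ∨ (P.X v ≤ 0 ∧ P.Y v ≤ 0) := by
  rcases D.coef_sign hv with h | h
  · exact Or.inl ⟨P.X_nonneg h, P.Y_nonneg h⟩
  · right
    have h' : ∀ i, 0 ≤ D.coef i (-v) := fun i => by rw [map_neg]; linarith [h i]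
    have hX := P.X_nonneg h'
    have hY := P.Y_nonneg h'
    rw [map_neg] at hX hY
    exact ⟨by linarith, by linarith⟩

/-- Let `p` and `q = ¬ p` be the two halves of the bipartition. A root with positive height on `p`
and height zero on `q` is positive, so all its coefficients on `q` vanish; and a positive root in
the span of an orthonormal set of simple roots is one of them. -/
theorem exists_eq_α_of_height {p q : Fin n → Prop} [DecidablePred p] [DecidablePred q]
    (hq : ∀ i, q i ↔ ¬ p i)
    (hporth : ∀ i j, p i → p j → i ≠ j → inner ℝ (D.α i) (D.α j) = 0)
    {v : Euc n} (hv : D.IsRoot v) (hX : 0 < P.height p v) (hY : P.height q v = 0) :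
    ∃ i, p i ∧ v = D.α i := by
  have hex : ∃ i, p i ∧ 0 < D.coef i v := by
    by_contra! h
    rw [height_apply] at hX
    refine absurd hX (not_lt.2 (Finset.sum_nonpos fun i hi => ?_))
    exact mul_nonpos_of_nonneg_of_nonpos (P.x_pos i).le (h i (by simpa using hi))
  obtain ⟨i, hi, hpos⟩ := hex
  have hnn := D.coef_nonneg_of_pos hv hpos
  have hzero : ∀ j, q j → D.coef j v = 0 := by
    intro j hj
    rw [height_apply, Finset.sum_eq_zero_iff_of_nonneg fun k _ =>
      mul_nonneg (P.x_pos k).le (hnn k)] at hY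
    have := hY j (by simpa using hj)
    exact (mul_eq_zero.1 this).resolve_left (P.x_pos j).ne'
  have hinner : inner ℝ (D.α i) v = D.coef i v := by
    rw [real_inner_comm, D.inner_eq_sum_coef, Finset.sum_eq_single i]
    · rw [real_inner_self_eq_norm_sq, D.norm_α]
      norm_num
    · intro j _ hj
      by_cases hpj : p j
      · rw [hporth j i hpj hi hj, mul_zero]
      · rw [hzero j ((hq j).2 hpj), zero_mul]
    · simp
  refine ⟨i, hi, (D.coef_R_α_nonneg hv hnn i).resolve_right fun h => ?_⟩
  -- the reflection in `αᵢ` changes the sign of the positive coefficient of `αᵢ`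
  have := h i
  rw [coef_R_α, if_pos rfl, hinner] at this
  linarith

theorem exists_orbitRoot_zero {v : Euc n} (hv : D.IsRoot v) (h : P.OnRay v 0) :
    ∃ i : Fin n, i.val < D.s ∧ v = D.α i := by
  obtain ⟨r, hr, hX, hY⟩ := h
  apply P.exists_eq_α_of_height (fun _ => Iff.rfl) D.orthogonal_S₁ hv
  · change 0 < P.X v
    rw [hX]
    have := P.sin_θ_pos
    simp
    positivity
  · change P.Y v = 0
    rw [hY]
    simp

theorem exists_orbitRoot_neg_one {v : Euc n} (hv : D.IsRoot v) (h : P.OnRay v (-1)) :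
    ∃ i : Fin n, ¬ i.val < D.s ∧ v = -D.α i := by
  obtain ⟨r, hr, hX, hY⟩ := h
  obtain ⟨i, hi, hvi⟩ := P.exists_eq_α_of_height (p := fun i => ¬ i.val < D.s)
    (fun _ => not_not.symm) orth₂ hv.neg (by
      change 0 < P.Y (-v)
      rw [map_neg, hY]
      have := P.sin_θ_pos
      simp
      positivity) (by
      change P.X (-v) = 0
      rw [map_neg, hX]
      simp)
  exact ⟨i, hi, by rw [← hvi, neg_neg]⟩

/-- The roots on the `j`-th ray are the orbit roots numbered by it. -/
theorem exists_orbitRoot {v : Euc n} (hv : D.IsRoot v) {j : ℤ} (h : P.OnRay v j) :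
    ∃ k i, D.ray k i = j ∧ D.orbitRoot k i = v := by
  have hroot : ∀ k : ℤ, D.IsRoot ((D.c ^ (-k)) v) := fun k => hv.map (D.W.zpow_mem D.c_mem _)
  have hinv : ∀ k : ℤ, (D.c ^ k) ((D.c ^ (-k)) v) = v := by
    intro k
    rw [← c_zpow_add_apply, add_neg_cancel, c_zpow_zero_apply]
  have hray : ∀ k : ℤ, P.OnRay ((D.c ^ (-k)) v) (j - 2 * k) := by
    intro k
    rw [show j - 2 * k = j + 2 * (-k) by ring, onRay_zpow_iff]
    exact h
  rcases Int.even_or_odd' j with ⟨k, rfl | rfl⟩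
  · obtain ⟨i, hi, he⟩ := P.exists_orbitRoot_zero (hroot k) (by simpa using hray k)
    exact ⟨k, i, by simp [ray, hi], by rw [orbitRoot, if_pos hi, ← he, hinv]⟩
  · obtain ⟨i, hi, he⟩ := P.exists_orbitRoot_neg_one (hroot (k + 1)) (by
      have := hray (k + 1)
      rwa [show 2 * k + 1 - 2 * (k + 1) = -1 by ring] at this)
    exact ⟨k, i, by simp [ray, hi], by rw [orbitRoot, if_neg hi, ← map_neg, ← he, hinv]⟩

/-- No root lies strictly between the last positive and the first negative ray, so `θ` divides
`π`. -/
theorem exists_mul_θ_eq_pi : ∃ m : ℕ, m * P.θ = Real.pi := by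
  have hn := D.isIrreducible.rank_pos
  -- if one half of the bipartition is empty, the eigenvalue is `1` and `θ = π / 2`
  have hcos : (∀ i j, i ≠ j → inner ℝ (D.α i) (D.α j) = 0) → ∃ m : ℕ, m * P.θ = Real.pi := by
    intro h
    have h1 := P.eigen ⟨0, hn⟩
    rw [Finset.sum_eq_single ⟨0, hn⟩ (fun j _ hj => by rw [h _ _ hj.symm, mul_zero]) (by simp),
      real_inner_self_eq_norm_sq, D.norm_α] at h1
    have h2 := P.x_pos ⟨0, hn⟩
    have h3 : Real.cos P.θ = 0 := by
      have : Real.cos P.θ * P.x ⟨0, hn⟩ = 0 := by linarith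
      exact (mul_eq_zero.1 this).resolve_right h2.ne'
    have h4 : P.θ = Real.pi / 2 := by
      apply Real.injOn_cos ⟨P.θ_pos.le, P.θ_le.trans (half_le_self Real.pi_pos.le)⟩
        ⟨by positivity, half_le_self Real.pi_pos.le⟩
      rw [h3, Real.cos_pi_div_two]
    exact ⟨2, by rw [h4]; push_cast; ring⟩
  by_cases h₁ : ∃ i : Fin n, i.val < D.s
  swap
  · push Not at h₁
    exact hcos fun i j hij => D.orthogonal_S₂ i j (h₁ i) (h₁ j) hij
  by_cases h₂ : ∃ i : Fin n, ¬ i.val < D.s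
  swap
  · push Not at h₂
    exact hcos fun i j hij => D.orthogonal_S₁ i j (h₂ i) (h₂ j) hij
  obtain ⟨i₁, hi₁⟩ := h₁
  obtain ⟨i₂, hi₂⟩ := h₂
  have hex : ∀ j : ℤ, ∃ v, D.IsRoot v ∧ P.OnRay v j := by
    intro j
    rcases Int.even_or_odd' j with ⟨k, rfl | rfl⟩
    · exact ⟨_, D.isRoot_orbitRoot k i₁, by simpa [ray, hi₁] using P.onRay_orbitRoot k i₁⟩
    · exact ⟨_, D.isRoot_orbitRoot k i₂, by simpa [ray, hi₂] using P.onRay_orbitRoot k i₂⟩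
  refine ⟨⌊Real.pi / P.θ⌋₊, ?_⟩
  set m := ⌊Real.pi / P.θ⌋₊
  have hle : m * P.θ ≤ Real.pi :=
    (le_div_iff₀ P.θ_pos).1 (Nat.floor_le (div_nonneg Real.pi_pos.le P.θ_pos.le))
  have hlt : Real.pi < (m + 1) * P.θ := (div_lt_iff₀ P.θ_pos).1 (Nat.lt_floor_add_one _)
  refine le_antisymm hle (not_lt.1 fun hlt' => ?_)
  have hθ := P.θ_pos
  have hθ' := P.θ_le
  have hπ := Real.pi_pos
  -- otherwise every ray carries a root; if `mθ < π < (m + 1)θ`, one on the ray `m` has `X < 0 < Y`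
  obtain ⟨v, hv, r, hr, hX, hY⟩ := hex m
  have hs : 0 < Real.sin (m * P.θ) := Real.sin_pos_of_pos_of_lt_pi (by linarith) hlt'
  have hs' : Real.sin ((m + 1) * P.θ) < 0 := by
    rw [← Real.sin_sub_two_pi]
    exact Real.sin_neg_of_neg_of_neg_pi_lt (by linarith) (by linarith)
  push_cast at hX hY
  have h1 : 0 < P.Y v := by rw [hY]; positivity
  have h2 : P.X v < 0 := by rw [hX]; exact mul_neg_of_pos_of_neg hr hs'
  rcases P.X_Y_sign hv with h | h <;> linarith [h.1, h.2]

variable {m : ℕ} (hm : m * P.θ = Real.pi)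

include hm in
theorem two_le_of_mul_θ : 2 ≤ m := by
  by_contra! h
  have hle : (m : ℝ) ≤ 1 := by exact_mod_cast Nat.lt_succ_iff.1 h
  have := P.θ_le
  have := P.θ_pos
  have := Real.pi_pos
  nlinarith

include hm in
theorem onRay_neg {v : Euc n} {j : ℤ} (h : P.OnRay v j) : P.OnRay (-v) (j + m) := by
  obtain ⟨r, hr, hX, hY⟩ := h
  refine ⟨r, hr, ?_, ?_⟩
  · push_cast
    rw [map_neg, hX, add_right_comm, add_mul _ (m : ℝ) P.θ, hm, Real.sin_add_pi, mul_neg]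
  · push_cast
    rw [map_neg, hY, add_mul _ _ P.θ, hm, Real.sin_add_pi, mul_neg]

include hm in
theorem onRay_neg' {v : Euc n} {j : ℤ} (h : P.OnRay v j) : P.OnRay (-v) (j - m) := by
  obtain ⟨r, hr, hX, hY⟩ := h
  refine ⟨r, hr, ?_, ?_⟩
  · push_cast
    rw [map_neg, hX, sub_add_eq_add_sub, sub_mul, hm, Real.sin_sub_pi, mul_neg]
  · push_cast
    rw [map_neg, hY, sub_mul _ _ P.θ, hm, Real.sin_sub_pi, mul_neg]

include hm in
/-- The involution `c₊` maps the `j`-th ray to the opposite of the `(-j)`-th. -/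
theorem onRay_cPlus {v : Euc n} {j : ℤ} (h : P.OnRay v j) : P.OnRay (D.cPlus v) (m - j) := by
  have h1 : P.OnRay (-D.cPlus v) (-j) := by
    obtain ⟨r, hr, hX, hY⟩ := h
    have h2 := sin_recurrence P.θ j
    refine ⟨r, hr, ?_, ?_⟩
    · rw [map_neg, X_cPlus, hX, hY]
      push_cast
      rw [h2, show (-(j : ℝ) + 1) * P.θ = -((j - 1) * P.θ) by ring, Real.sin_neg]
      ring
    · rw [map_neg, Y_cPlus, hY]
      push_cast
      rw [neg_mul, Real.sin_neg, mul_neg]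
  have h2 := P.onRay_neg hm h1
  rwa [neg_neg, neg_add_eq_sub] at h2

include hm in
/-- A vector lies on at most one of the `2m` rays. -/
theorem dvd_of_onRay {v : Euc n} {i j : ℤ} (hi : P.OnRay v i) (hj : P.OnRay v j) :
    (2 * m : ℤ) ∣ i - j := by
  obtain ⟨r, hr, hX, hY⟩ := hi
  obtain ⟨r', hr', hX', hY'⟩ := hj
  have hm2 := P.two_le_of_mul_θ hm
  have hm0 : (m : ℝ) ≠ 0 := by
    have : m ≠ 0 := by omega
    exact_mod_cast this
  have hs := P.sin_θ_pos
  have hθ := P.θ_pos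
  have e1 : r * Real.sin ((i + 1) * P.θ) = r' * Real.sin ((j + 1) * P.θ) := by rw [← hX, hX']
  have e2 : r * Real.sin (i * P.θ) = r' * Real.sin (j * P.θ) := by rw [← hY, hY']
  rw [add_mul, add_mul, one_mul, Real.sin_add, Real.sin_add] at e1
  -- both coordinates of the unit vectors at the angles `iθ` and `jθ` agree up to the factors
  have e3 : r * Real.cos (i * P.θ) = r' * Real.cos (j * P.θ) := by
    have : Real.sin P.θ * (r * Real.cos (i * P.θ)) = Real.sin P.θ * (r' * Real.cos (j * P.θ)) := by
      linear_combination e1 - Real.cos P.θ * e2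
    exact mul_left_cancel₀ hs.ne' this
  have hrr : r = r' := by
    have s1 := Real.sin_sq_add_cos_sq (i * P.θ)
    have s2 := Real.sin_sq_add_cos_sq (j * P.θ)
    have : r ^ 2 = r' ^ 2 := by
      linear_combination (r * Real.sin (i * P.θ) + r' * Real.sin (j * P.θ)) * e2
        + (r * Real.cos (i * P.θ) + r' * Real.cos (j * P.θ)) * e3 - r ^ 2 * s1 + r' ^ 2 * s2
    exact (pow_left_inj₀ hr.le hr'.le two_ne_zero).1 this
  rw [hrr] at e2 e3
  have hsin := mul_left_cancel₀ hr'.ne' e2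
  have hcos := mul_left_cancel₀ hr'.ne' e3
  have hone : Real.cos (((i - j : ℤ) : ℝ) * P.θ) = 1 := by
    push_cast
    rw [sub_mul, Real.cos_sub, hsin, hcos, ← Real.sin_sq_add_cos_sq (j * P.θ)]
    ring
  obtain ⟨k, hk⟩ := (Real.cos_eq_one_iff _).1 hone
  refine ⟨k, ?_⟩
  rw [← hm] at hk
  have : (k * (2 * m) : ℝ) = ((i - j : ℤ) : ℝ) := mul_right_cancel₀ hθ.ne' (by rw [← hk]; ring)
  have : k * (2 * m) = i - j := by exact_mod_cast this
  rw [← this, mul_comm]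

include hm in
/-- The Coxeter number is `π / θ`. The power `c ^ m` fixes all rays, so it maps simple roots to
simple roots and is the identity by the exchange argument; conversely `c ^ h = 1` fixes a ray, which
forces `m ∣ h`. -/
theorem h_eq : D.h = m := by
  have hn := D.isIrreducible.rank_pos
  have hm2 := P.two_le_of_mul_θ hm
  have hperiod : ∀ (v : Euc n) (j : ℤ), P.OnRay v j → P.OnRay ((D.c ^ m) v) j := by
    intro v j h
    have h1 := P.onRay_neg' hm (P.onRay_neg' hm ((P.onRay_zpow_iff m).2 h))
    rwa [neg_neg, zpow_natCast, show j + 2 * m - m - m = j by ring] at h1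
  have hroot : ∀ i, D.IsRoot ((D.c ^ m) (D.α i)) := fun i =>
    (D.isRoot_α i).map (D.W.pow_mem D.c_mem m)
  apply Nat.dvd_antisymm
  · apply orderOf_dvd_of_pow_eq_one
    have hword : ((List.replicate m (List.finRange n)).flatten.map fun i => R (D.α i)).prod
        = D.c ^ m := by
      simp [List.map_flatten, List.prod_flatten, c]
    rw [← hword]
    apply D.prod_eq_one_of_nonneg
    intro i j
    rw [hword]
    have hsimple : ∃ k, (D.c ^ m) (D.α i) = D.α k := by
      by_cases hi : i.val < D.s
      · obtain ⟨k, -, hk⟩ := P.exists_orbitRoot_zero (hroot i) (hperiod _ _ (P.onRay_α hi))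
        exact ⟨k, hk⟩
      · have h := hperiod _ _ (P.onRay_neg_α hi)
        rw [map_neg] at h
        obtain ⟨k, -, hk⟩ := P.exists_orbitRoot_neg_one (hroot i).neg h
        exact ⟨k, neg_inj.1 hk⟩
    obtain ⟨k, hk⟩ := hsimple
    rw [hk, coef_α]
    split_ifs <;> norm_num
  · have h1 : D.orbitRoot D.h ⟨0, hn⟩ = D.orbitRoot 0 ⟨0, hn⟩ := by
      have hc : D.c ^ (D.h : ℤ) = 1 := by
        rw [zpow_natCast]
        exact pow_orderOf_eq_one D.c
      rw [← add_zero (D.h : ℤ), ← c_zpow_orbitRoot, hc]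
      rfl
    have h2 := P.onRay_orbitRoot D.h ⟨0, hn⟩
    rw [h1] at h2
    have h3 := P.dvd_of_onRay hm h2 (P.onRay_orbitRoot 0 ⟨0, hn⟩)
    have h4 : D.ray D.h ⟨0, hn⟩ - D.ray 0 ⟨0, hn⟩ = 2 * D.h := by
      unfold ray
      split_ifs <;> ring
    rw [h4] at h3
    exact_mod_cast Int.dvd_of_mul_dvd_mul_left two_ne_zero h3

end Perron

/-! ### The cyclic list of roots -/

/-- The number `k` of full turns in the index `i = nk + r + 1`, `0 ≤ r < n`. -/
def turn (n : ℕ) (i : ℤ) : ℤ := (i - 1) / n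

/-- The position `r` within a turn in the index `i = nk + r + 1`, `0 ≤ r < n`. -/
def pos (i : ℤ) : Fin n := ⟨((i - 1) % n).toNat, by
  have := D.isIrreducible.rank_pos
  have h1 := Int.emod_nonneg (i - 1) (b := n) (by omega)
  have h2 := Int.emod_lt_of_pos (i - 1) (b := n) (by omega)
  omega⟩

theorem index_eq (i : ℤ) : i = n * turn n i + (D.pos i).val + 1 := by
  have := D.isIrreducible.rank_pos
  have h1 := Int.emod_nonneg (i - 1) (b := n) (by omega)
  have h2 := Int.mul_ediv_add_emod (i - 1) n
  unfold turn pos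
  simp only
  omega

theorem turn_pos_eq (k : ℤ) (r : Fin n) :
    turn n (n * k + r.val + 1) = k ∧ D.pos (n * k + r.val + 1) = r := by
  have hn := D.isIrreducible.rank_pos
  have hn0 : (n : ℤ) ≠ 0 := by omega
  have hr := r.isLt
  have h1 : turn n (n * k + r.val + 1) = k := by
    rw [turn, add_sub_cancel_right, Int.add_comm, Int.add_mul_ediv_left _ _ hn0,
      Int.ediv_eq_zero_of_lt (by omega) (by omega), zero_add]
  refine ⟨h1, ?_⟩
  have h2 := D.index_eq (n * k + r.val + 1)
  rw [h1] at h2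
  ext
  omega

/-- The root `ρᵢ`, extended periodically to all integers `i`. -/
noncomputable def cycRoot (i : ℤ) : Euc n := D.orbitRoot (turn n i) (D.pos i)

/-- The number of the block of pairwise orthogonal roots to which `ρᵢ` belongs: the blocks are the
translates of `S₁` and `c₊ S₂` under the powers of `c`, and they are numbered in their cyclic
order. -/
def block (i : ℤ) : ℤ := D.ray (turn n i) (D.pos i)

theorem alphaCyc_val (i : Fin n) : D.alphaCyc i.val = D.α i := by
  unfold alphaCyc
  congr 1
  ext
  exact Nat.mod_eq_of_lt i.isLt

theorem map_take_finRange (r : ℕ) (hr : r ≤ n) :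
    (((List.finRange n).take r).map fun i => R (D.α i))
      = (List.range r).map fun j => R (D.alphaCyc j) := by
  apply List.ext_getElem
  · simp [hr]
  · intro j h1 h2
    simp [← alphaCyc_val]

theorem cPlus_eq : D.cPlus = ((List.range D.s).map fun j => R (D.alphaCyc j)).prod := by
  rw [cPlus, map_take_finRange D _ D.s_le]

theorem c_eq_range : D.c = ((List.range n).map fun j => R (D.alphaCyc j)).prod := by
  rw [c, ← map_take_finRange D n le_rfl, List.take_of_length_le (by simp)]

theorem rhoSucc_add (m : ℕ) : D.rhoSucc (n + m) = D.c (D.rhoSucc m) := by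
  have h : ∀ j, D.alphaCyc (n + j) = D.alphaCyc j := by
    intro j
    simp [alphaCyc]
  unfold rhoSucc
  rw [List.range_add, List.map_append, List.prod_append, ← c_eq_range, h, List.map_map]
  simp only [Function.comp_def, h]
  rfl

theorem prod_R_fix {ι : Type*} (l : List ι) (a : ι → Euc n) (v : Euc n)
    (h : ∀ i ∈ l, inner ℝ (a i) v = 0) : (l.map fun i => R (a i)).prod v = v := by
  induction l with
  | nil => simp
  | cons i l ih =>
    rw [List.map_cons, List.prod_cons]
    change R (a i) ((l.map fun i => R (a i)).prod v) = v
    rw [ih fun j hj => h j (by simp [hj]), R_fix _ _ (h i (by simp))]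

theorem rhoSucc_of_lt (r : Fin n) : D.rhoSucc r.val = D.orbitRoot 0 r := by
  unfold rhoSucc orbitRoot
  rw [alphaCyc_val]
  split_ifs with hr
  · rw [c_zpow_zero_apply]
    apply prod_R_fix
    intro j hj
    rw [List.mem_range] at hj
    have := D.alphaCyc_val ⟨j, hj.trans r.isLt⟩
    simp only at this
    rw [this]
    exact D.orthogonal_S₁ _ _ (hj.trans hr) hr fun h => by
      have := congrArg Fin.val h
      simp only at this
      omega
  · rw [zero_add, zpow_one, c_eq]
    change _ = -D.cPlus (D.cMinus (D.α r))
    rw [D.cMinus_α hr, map_neg, neg_neg]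
    have h1 : r.val = D.s + (r.val - D.s) := by omega
    rw [h1, List.range_add, List.map_append, List.prod_append, ← cPlus_eq, List.map_map]
    change D.cPlus _ = _
    congr 1
    apply prod_R_fix (List.range (r.val - D.s)) (fun j => D.alphaCyc (D.s + j))
    intro j hj
    rw [List.mem_range] at hj
    have := D.alphaCyc_val ⟨D.s + j, by omega⟩
    simp only at this
    rw [this]
    exact D.orthogonal_S₂ _ _ (by simp) (not_lt.1 hr) fun h => by
      have := congrArg Fin.val h
      simp only at this
      omega

theorem rhoSucc_eq (m : ℕ) : D.rhoSucc m = D.cycRoot (m + 1) := by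
  have hn := D.isIrreducible.rank_pos
  have key : ∀ (q : ℕ) (r : Fin n), D.rhoSucc (n * q + r.val) = D.orbitRoot q r := by
    intro q r
    induction q with
    | zero => simpa using D.rhoSucc_of_lt r
    | succ q ih =>
      rw [show n * (q + 1) + r.val = n + (n * q + r.val) by ring, rhoSucc_add, ih,
        ← zpow_one D.c, c_zpow_orbitRoot]
      push_cast
      rw [add_comm]
  have h1 := key (m / n) ⟨m % n, Nat.mod_lt m hn⟩
  simp only [Nat.div_add_mod] at h1
  rw [h1, cycRoot]
  have h2 := D.turn_pos_eq (m / n : ℕ) ⟨m % n, Nat.mod_lt m hn⟩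
  have h3 : ((n : ℤ) * (m / n : ℕ) + (m % n : ℕ) + 1) = m + 1 := by
    have := Nat.div_add_mod m n
    exact_mod_cast congrArg (· + 1) this
  simp only [h3] at h2
  rw [h2.1, h2.2]

theorem cycRoot_add_period (i : ℤ) : D.cycRoot (i + n * D.h) = D.cycRoot i := by
  have h1 := D.index_eq i
  have h2 := D.turn_pos_eq (turn n i + D.h) (D.pos i)
  rw [show n * (turn n i + D.h) + (D.pos i).val + 1 = i + n * D.h by linarith] at h2
  have hc : D.c ^ (D.h : ℤ) = 1 := by
    rw [zpow_natCast]
    exact pow_orderOf_eq_one D.c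
  rw [cycRoot, h2.1, h2.2, add_comm, ← c_zpow_orbitRoot, hc]
  rfl

theorem rho_eq_cycRoot {i : ℤ} (hi : -(n * D.h : ℤ) < i) : D.rho i = D.cycRoot i := by
  unfold rho
  split_ifs with h
  · rw [rhoSucc_eq]
    congr 1
    omega
  · rw [rhoSucc_eq, ← D.cycRoot_add_period i, Int.toNat_of_nonneg (by push_cast; omega)]
    congr 1
    push_cast
    ring

theorem isRoot_cycRoot (i : ℤ) : D.IsRoot (D.cycRoot i) := D.isRoot_orbitRoot _ _

/-! ### Blocks and index ranges -/

theorem block_le_two_mul_iff (i q : ℤ) : D.block i ≤ 2 * q ↔ i ≤ n * q + D.s := by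
  have h1 := D.index_eq i
  have h2 := (D.pos i).isLt
  have h3 := D.s_le
  unfold block ray
  rcases lt_trichotomy (turn n i) q with h | h | h
  · have : (n : ℤ) * (turn n i + 1) ≤ n * q := mul_le_mul_of_nonneg_left h (by omega)
    split_ifs <;> constructor <;> intro <;> nlinarith
  · rw [h] at h1 ⊢
    split_ifs <;> omega
  · have : (n : ℤ) * (q + 1) ≤ n * turn n i := mul_le_mul_of_nonneg_left h (by omega)
    split_ifs <;> constructor <;> intro <;> nlinarith

theorem block_le_two_mul_add_one_iff (i q : ℤ) : D.block i ≤ 2 * q + 1 ↔ i ≤ n * q + n := by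
  have h1 := D.index_eq i
  have h2 := (D.pos i).isLt
  have h3 := D.s_le
  unfold block ray
  rcases lt_trichotomy (turn n i) q with h | h | h
  · have : (n : ℤ) * (turn n i + 1) ≤ n * q := mul_le_mul_of_nonneg_left h (by omega)
    split_ifs <;> constructor <;> intro <;> nlinarith
  · rw [h] at h1 ⊢
    split_ifs <;> omega
  · have : (n : ℤ) * (q + 1) ≤ n * turn n i := mul_le_mul_of_nonneg_left h (by omega)
    split_ifs <;> constructor <;> intro <;> nlinarith

theorem neg_one_le_block_iff (i : ℤ) : -1 ≤ D.block i ↔ -(n : ℤ) + D.s + 1 ≤ i := by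
  have := D.block_le_two_mul_iff i (-1)
  omega

theorem zero_le_block_iff (i : ℤ) : 0 ≤ D.block i ↔ 1 ≤ i := by
  have := D.block_le_two_mul_add_one_iff i (-1)
  omega

theorem block_mono {i j : ℤ} (h : i ≤ j) : D.block i ≤ D.block j := by
  rcases Int.even_or_odd' (D.block j) with ⟨q, hq | hq⟩
  · rw [hq, block_le_two_mul_iff]
    exact h.trans ((D.block_le_two_mul_iff j q).1 hq.le)
  · rw [hq, block_le_two_mul_add_one_iff]
    exact h.trans ((D.block_le_two_mul_add_one_iff j q).1 hq.le)

theorem exists_perron_h : ∃ P : D.Perron, D.h * P.θ = Real.pi := by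
  obtain ⟨P⟩ := D.nonempty_perron
  obtain ⟨m, hm⟩ := P.exists_mul_θ_eq_pi
  exact ⟨P, by rw [P.h_eq hm]; exact hm⟩

theorem two_le_h : 2 ≤ D.h := by
  obtain ⟨P, hP⟩ := D.exists_perron_h
  exact P.two_le_of_mul_θ hP

/-- A root on the `j`-th ray is one of the roots of the `j`-th block. -/
theorem exists_cycRoot (P : D.Perron) {v : Euc n} (hv : D.IsRoot v) {j : ℤ} (h : P.OnRay v j) :
    ∃ i, D.block i = j ∧ D.cycRoot i = v := by
  obtain ⟨k, r, h1, h2⟩ := P.exists_orbitRoot hv h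
  have h3 := D.turn_pos_eq k r
  exact ⟨n * k + r.val + 1, by rw [block, h3.1, h3.2, h1], by rw [cycRoot, h3.1, h3.2, h2]⟩

theorem ray_injective {k l : ℤ} {i j : Fin n} (h : D.ray k i = D.ray l j) :
    k = l ∧ (i.val < D.s ↔ j.val < D.s) := by
  unfold ray at h
  split_ifs at h <;> omega

theorem α_injective {i j : Fin n} (h : D.α i = D.α j) : i = j :=
  D.linearIndependent_α.injective h

theorem orbitRoot_inj {k : ℤ} {i j : Fin n} (hij : i.val < D.s ↔ j.val < D.s)
    (h : D.orbitRoot k i = D.orbitRoot k j) : i = j := by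
  unfold orbitRoot at h
  by_cases hi : i.val < D.s
  · rw [if_pos hi, if_pos (hij.1 hi)] at h
    exact D.α_injective ((D.c ^ k).injective h)
  · rw [if_neg hi, if_neg (hij.not.1 hi)] at h
    exact D.α_injective ((D.c ^ (k + 1)).injective (neg_injective h))

theorem cycRoot_inj {i j : ℤ} (h : D.cycRoot i = D.cycRoot j)
    (h1 : D.block i - D.block j < 2 * D.h) (h2 : D.block j - D.block i < 2 * D.h) : i = j := by
  obtain ⟨P, hP⟩ := D.exists_perron_h
  have hi := P.onRay_orbitRoot (turn n i) (D.pos i)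
  have hj := P.onRay_orbitRoot (turn n j) (D.pos j)
  change P.OnRay (D.cycRoot i) (D.block i) at hi
  change P.OnRay (D.cycRoot j) (D.block j) at hj
  rw [← h] at hj
  have h0 : D.block i = D.block j := by
    have := Int.eq_zero_of_abs_lt_dvd (P.dvd_of_onRay hP hi hj) (abs_lt.2 ⟨by omega, h1⟩)
    omega
  obtain ⟨ht, hs⟩ := D.ray_injective h0
  rw [cycRoot, cycRoot, ht] at h
  rw [D.index_eq i, D.index_eq j, ht, D.orbitRoot_inj hs h]

/-- Roots in the same block are equal or orthogonal. -/
theorem commute_of_block_eq {i j : ℤ} (h : D.block i = D.block j) :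
    Commute (R (D.cycRoot i)) (R (D.cycRoot j)) := by
  obtain ⟨ht, hs⟩ := D.ray_injective h
  rcases eq_or_ne (D.pos i) (D.pos j) with hp | hp
  · rw [cycRoot, cycRoot, ht, hp]
  · apply commute_R
    rw [cycRoot, cycRoot, ht]
    unfold orbitRoot
    by_cases hi : (D.pos i).val < D.s
    · rw [if_pos hi, if_pos (hs.1 hi), LinearIsometryEquiv.inner_map_map]
      exact D.orthogonal_S₁ _ _ hi (hs.1 hi) hp
    · rw [if_neg hi, if_neg (hs.not.1 hi), inner_neg_neg, LinearIsometryEquiv.inner_map_map]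
      exact D.orthogonal_S₂ _ _ (not_lt.1 hi) (not_lt.1 (hs.not.1 hi)) hp

/-- If the Coxeter number is odd, negation exchanges `S₁` with a block of the other type, so the two
halves of the bipartition have the same size. -/
theorem two_mul_s_of_odd {q : ℕ} (hq : D.h = 2 * q + 1) : n = 2 * D.s := by
  classical
  obtain ⟨P, hP⟩ := D.exists_perron_h
  have hinj : ∀ (w : Orth n), Function.Injective fun i => -w (D.α i) := fun w i j h =>
    D.α_injective (w.injective (neg_injective h))
  have hmem : ∀ w ∈ D.W, ∀ i, D.IsRoot (-w (D.α i)) := fun w hw i => ((D.isRoot_α i).map hw).neg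
  have himage : (Finset.univ.filter fun i : Fin n => i.val < D.s).image
        (fun i => -(1 : Orth n) (D.α i))
      = (Finset.univ.filter fun i : Fin n => ¬ i.val < D.s).image
        (fun i => -(D.c ^ ((q : ℤ) + 1)) (D.α i)) := by
    ext v
    simp only [Finset.mem_image, Finset.mem_filter, Finset.mem_univ, true_and]
    constructor
    · rintro ⟨i, hi, rfl⟩
      have h1 := P.onRay_neg hP (P.onRay_α hi)
      obtain ⟨k, r, hk, hr⟩ := P.exists_orbitRoot (hmem 1 D.W.one_mem i) h1
      unfold ray at hk
      unfold orbitRoot at hr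
      split_ifs at hk hr with hrs
      · omega
      · obtain rfl : k = q := by omega
        exact ⟨r, hrs, hr⟩
    · rintro ⟨i, hi, rfl⟩
      have h1 := P.onRay_orbitRoot q i
      have h2 := P.onRay_neg' hP h1
      have h3 : D.ray q i - D.h = 0 := by
        rw [ray, if_neg hi, hq]
        push_cast
        ring
      rw [h3] at h2
      obtain ⟨r, hr, he⟩ := P.exists_orbitRoot_zero (D.isRoot_orbitRoot q i).neg h2
      refine ⟨r, hr, ?_⟩
      rw [orbitRoot, if_neg hi] at he
      rw [← he]
      simp
  have hcard := congrArg Finset.card himage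
  rw [Finset.card_image_of_injective _ (hinj _), Finset.card_image_of_injective _ (hinj _),
    Fin.card_filter_val_lt] at hcard
  have htot := Finset.card_filter_add_card_filter_not (s := (Finset.univ : Finset (Fin n)))
    (fun i => i.val < D.s)
  rw [← hcard, Fin.card_filter_val_lt, Finset.card_univ, Fintype.card_fin] at htot
  have := D.s_le
  omega

theorem block_le_h_iff (i : ℤ) : D.block i ≤ D.h ↔ i ≤ ((n * D.h / 2 + D.s : ℕ) : ℤ) := by
  rcases Nat.even_or_odd' D.h with ⟨q, hq | hq⟩
  · have h1 : n * D.h / 2 = n * q := by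
      rw [hq, show n * (2 * q) = n * q * 2 by ring, Nat.mul_div_cancel _ two_pos]
    rw [h1, hq]
    push_cast
    exact D.block_le_two_mul_iff i q
  · have hs := D.two_mul_s_of_odd hq
    have h1 : n * D.h / 2 = n * q + D.s := by
      have : n * D.h = (n * q + D.s) * 2 := by
        rw [hq, mul_add, mul_one, add_mul]
        nth_rewrite 2 [hs]
        ring
      rw [this, Nat.mul_div_cancel _ two_pos]
    rw [h1, hq]
    push_cast
    rw [block_le_two_mul_add_one_iff]
    omega

theorem block_le_h_add_one_iff (i : ℤ) :
    D.block i ≤ D.h + 1 ↔ i ≤ ((n * D.h / 2 + n : ℕ) : ℤ) := by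
  rcases Nat.even_or_odd' D.h with ⟨q, hq | hq⟩
  · have h1 : n * D.h / 2 = n * q := by
      rw [hq, show n * (2 * q) = n * q * 2 by ring, Nat.mul_div_cancel _ two_pos]
    rw [h1, hq]
    push_cast
    exact D.block_le_two_mul_add_one_iff i q
  · have hs := D.two_mul_s_of_odd hq
    have h1 : n * D.h / 2 = n * q + D.s := by
      have : n * D.h = (n * q + D.s) * 2 := by
        rw [hq, mul_add, mul_one, add_mul]
        nth_rewrite 2 [hs]
        ring
      rw [this, Nat.mul_div_cancel _ two_pos]
    rw [h1, hq]
    push_cast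
    have := D.block_le_two_mul_iff i (q + 1)
    rw [show (2 * q + 1 + 1 : ℤ) = 2 * (q + 1) by ring, this, mul_add, mul_one]
    omega

theorem rho_eq_of_block {i : ℤ} (hi : -1 ≤ D.block i) : D.rho i = D.cycRoot i := by
  apply D.rho_eq_cycRoot
  rw [neg_one_le_block_iff] at hi
  have h2 := D.two_le_h
  have hn := D.isIrreducible.rank_pos
  have : (n : ℤ) * 2 ≤ n * D.h := mul_le_mul_of_nonneg_left (by exact_mod_cast h2) (by omega)
  omega

end Setting

/-! ### Products over blocks and reflection length -/

/-- Two block-monotone arrangements of the same factors have the same product if factors from the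
same block commute. -/
theorem prod_map_eq_of_perm {M ι : Type*} [Monoid M] (f : ι → M) (b : ι → ℤ)
    (hcomm : ∀ i j, b i = b j → Commute (f i) (f j)) {l l' : List ι} (hp : l.Perm l')
    (hl : l.Pairwise fun i j => b i ≤ b j) (hl' : l'.Pairwise fun i j => b i ≤ b j) :
    (l.map f).prod = (l'.map f).prod := by
  induction l generalizing l' with
  | nil => rw [hp.nil_eq]
  | cons a t ih =>
    obtain ⟨u, v, rfl⟩ := List.append_of_mem (hp.subset (List.mem_cons_self))
    have hp' : t.Perm (u ++ v) := (List.perm_cons a).1 (hp.trans List.perm_middle)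
    rw [List.pairwise_cons] at hl
    rw [List.pairwise_append, List.pairwise_cons] at hl'
    have huv : (u ++ v).Pairwise fun i j => b i ≤ b j :=
      List.pairwise_append.2 ⟨hl'.1, hl'.2.1.2, fun x hx y hy => hl'.2.2 x hx y (by simp [hy])⟩
    have hc : Commute (f a) (u.map f).prod := by
      apply Commute.list_prod_right
      intro y hy
      obtain ⟨x, hx, rfl⟩ := List.mem_map.1 hy
      apply hcomm
      exact le_antisymm (hl.1 x (hp'.symm.subset (by simp [hx]))) (hl'.2.2 x hx a (by simp))
    rw [List.map_cons, List.prod_cons, ih hp' hl.2 huv]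
    simp only [List.map_append, List.prod_append, List.map_cons, List.prod_cons]
    rw [← mul_assoc, ← mul_assoc, hc.eq]

theorem reflLength_eq_of_forall {n : ℕ} {W : Subgroup (Orth n)} {w w' : Orth n}
    (h : ∀ l : List (Orth n), (∀ T ∈ l, T ∈ reflections W) → l.prod = w →
      ∃ l' : List (Orth n), (∀ T ∈ l', T ∈ reflections W) ∧ l'.prod = w' ∧ l'.length = l.length)
    (h' : ∀ l : List (Orth n), (∀ T ∈ l, T ∈ reflections W) → l.prod = w' →
      ∃ l' : List (Orth n), (∀ T ∈ l', T ∈ reflections W) ∧ l'.prod = w ∧ l'.length = l.length) :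
    reflLength W w = reflLength W w' := by
  unfold reflLength
  congr 1
  ext k
  constructor
  · rintro ⟨l, hl, hp, rfl⟩
    exact h l hl hp
  · rintro ⟨l, hl, hp, rfl⟩
    exact h' l hl hp

theorem reflLength_conj {n : ℕ} {W : Subgroup (Orth n)} {g : Orth n} (hg : g ∈ W) (w : Orth n) :
    reflLength W (g * w * g⁻¹) = reflLength W w := by
  have key : ∀ g ∈ W, ∀ l : List (Orth n), (∀ T ∈ l, T ∈ reflections W) →
      ∃ l' : List (Orth n), (∀ T ∈ l', T ∈ reflections W) ∧ l'.prod = g * l.prod * g⁻¹ ∧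
        l'.length = l.length := by
    intro g hg l hl
    refine ⟨l.map (MulAut.conj g), fun T hT => ?_, ?_, by simp⟩
    · obtain ⟨S, hS, rfl⟩ := List.mem_map.1 hT
      exact Setting.conj_mem hg (hl S hS)
    · rw [← map_list_prod, MulAut.conj_apply]
  apply reflLength_eq_of_forall
  · intro l hl hp
    obtain ⟨l', h1, h2, h3⟩ := key g⁻¹ (W.inv_mem hg) l hl
    refine ⟨l', h1, ?_, h3⟩
    rw [h2, hp]
    group
  · intro l hl hp
    obtain ⟨l', h1, h2, h3⟩ := key g hg l hl
    exact ⟨l', h1, by rw [h2, hp], h3⟩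

theorem reflLength_inv {n : ℕ} (W : Subgroup (Orth n)) (w : Orth n) :
    reflLength W w⁻¹ = reflLength W w := by
  have key : ∀ l : List (Orth n), (∀ T ∈ l, T ∈ reflections W) →
      ∃ l' : List (Orth n), (∀ T ∈ l', T ∈ reflections W) ∧ l'.prod = l.prod⁻¹ ∧
        l'.length = l.length := by
    intro l hl
    exact ⟨l.reverse, fun T hT => hl T (List.mem_reverse.1 hT),
      eq_inv_of_mul_eq_one_left (Setting.prod_reverse l hl), by simp⟩
  apply reflLength_eq_of_forall
  · intro l hl hp
    obtain ⟨l', h1, h2, h3⟩ := key l hl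
    exact ⟨l', h1, by rw [h2, hp, inv_inv], h3⟩
  · intro l hl hp
    obtain ⟨l', h1, h2, h3⟩ := key l hl
    exact ⟨l', h1, by rw [h2, hp], h3⟩

namespace Setting

variable {n : ℕ} (D : Setting n)

/-! ### The involution `c₊` reverses the list of roots -/

theorem R_cycRoot_mem (i : ℤ) : R (D.cycRoot i) ∈ reflections D.W := by
  have h := D.isRoot_cycRoot i
  exact ⟨h.2, _, fun h0 => by simpa [h0] using h.1, rfl⟩

theorem cPlus_mul_self : D.cPlus * D.cPlus = 1 := by
  ext1 v
  change D.cPlus (D.cPlus v) = v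
  have h : ∀ j ∈ Finset.univ.filter fun i : Fin n => i.val < D.s,
      D.cPlus ((2 * inner ℝ (D.α j) v) • D.α j) = -((2 * inner ℝ (D.α j) v) • D.α j) := by
    intro j hj
    rw [map_smul, D.cPlus_α (by simpa using hj), smul_neg]
  rw [D.cPlus_apply v, map_sub, map_sum, D.cPlus_apply v, Finset.sum_congr rfl h,
    Finset.sum_neg_distrib, sub_neg_eq_add, sub_add_cancel]

theorem cMinus_mul_self : D.cMinus * D.cMinus = 1 := by
  ext1 v
  change D.cMinus (D.cMinus v) = v
  have h : ∀ j ∈ Finset.univ.filter fun i : Fin n => ¬ i.val < D.s,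
      D.cMinus ((2 * inner ℝ (D.α j) v) • D.α j) = -((2 * inner ℝ (D.α j) v) • D.α j) := by
    intro j hj
    rw [map_smul, D.cMinus_α (by simpa using hj), smul_neg]
  rw [D.cMinus_apply v, map_sub, map_sum, D.cMinus_apply v, Finset.sum_congr rfl h,
    Finset.sum_neg_distrib, sub_neg_eq_add, sub_add_cancel]

theorem conj_cPlus_c : D.cPlus * D.c⁻¹ * D.cPlus⁻¹ = D.c := by
  have h1 : D.cPlus⁻¹ = D.cPlus := inv_eq_of_mul_eq_one_left D.cPlus_mul_self
  have h2 : D.cMinus⁻¹ = D.cMinus := inv_eq_of_mul_eq_one_left D.cMinus_mul_self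
  rw [c_eq, mul_inv_rev, h1, h2, mul_assoc, mul_assoc, D.cPlus_mul_self, mul_one]

/-- Conjugation by `c₊` inverts `c`, so it preserves reflection length after the order of the roots
has been reversed. -/
theorem reflLength_map_cPlus (l : List (Euc n)) :
    reflLength D.W ((l.reverse.map fun τ => R (D.cPlus τ)).prod * D.c)
      = reflLength D.W ((l.map R).prod * D.c) := by
  have h1 : (l.reverse.map fun τ => R (D.cPlus τ)).prod
      = D.cPlus * (l.map R).prod⁻¹ * D.cPlus⁻¹ := by
    induction l with
    | nil => simp
    | cons τ l ih =>
      have h2 : (R τ)⁻¹ = R τ := inv_eq_of_mul_eq_one_left (R_mul_self τ)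
      rw [List.reverse_cons, List.map_append, List.prod_append, ih, List.map_cons, List.map_nil,
        List.prod_singleton, List.map_cons, List.prod_cons, mul_inv_rev, h2, ← conj_R]
      group
  have h2 : (l.reverse.map fun τ => R (D.cPlus τ)).prod * D.c
      = D.cPlus * (D.c * ((l.map R).prod * D.c) * D.c⁻¹)⁻¹ * D.cPlus⁻¹ := by
    rw [h1]
    nth_rewrite 1 [← D.conj_cPlus_c]
    group
  rw [h2, reflLength_conj D.cPlus_mem, reflLength_inv, reflLength_conj D.c_mem]

theorem cPlus_cPlus (v : Euc n) : D.cPlus (D.cPlus v) = v := by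
  have := congrArg (fun g : Orth n => g v) D.cPlus_mul_self
  exact this

theorem exists_reflected_index (i : ℤ) :
    ∃ j, D.block j = D.h - D.block i ∧ D.cycRoot j = D.cPlus (D.cycRoot i) := by
  obtain ⟨P, hP⟩ := D.exists_perron_h
  exact D.exists_cycRoot P ((D.isRoot_cycRoot i).map D.cPlus_mem)
    (P.onRay_cPlus hP (P.onRay_orbitRoot (turn n i) (D.pos i)))

open Classical in
/-- The image under `c₊` of a set of roots, listed in increasing order with blocks between `p` and
`q`, is again such a set, with blocks between `h - q` and `h - p` and with the same length. The
image of the list, reversed, is increasing up to a reordering inside the blocks, where the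
reflections commute. -/
theorem exists_reflected_list {p q : ℤ} (hp : -1 ≤ p) (hq : q ≤ D.h + 1) (hpq : q - p ≤ D.h + 1)
    {l : List ℤ} (hl : l.Pairwise (· < ·)) (hlb : ∀ i ∈ l, p ≤ D.block i ∧ D.block i ≤ q) :
    ∃ l' : List ℤ, l'.Pairwise (· < ·) ∧
      (∀ i ∈ l', D.h - q ≤ D.block i ∧ D.block i ≤ D.h - p) ∧
      D.rootSet l' = (D.rootSet l).image D.cPlus ∧ l'.length = l.length ∧ D.len l' = D.len l := by
  have hh := D.two_le_h
  choose φ hφb hφ using D.exists_reflected_index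
  have hinj : ∀ i ∈ l, ∀ j ∈ l, φ i = φ j → i = j := by
    intro i hi j hj hij
    have h1 : D.cycRoot i = D.cycRoot j := by
      apply D.cPlus.injective
      rw [← hφ, ← hφ, hij]
    have := hlb i hi
    have := hlb j hj
    exact D.cycRoot_inj h1 (by omega) (by omega)
  set l₁ := (l.map φ).reverse with hl₁
  have hnodup : l₁.Nodup := by
    rw [hl₁, List.nodup_reverse]
    exact List.Nodup.map_on hinj (hl.imp fun h => h.ne)
  have hl₁b : l₁.Pairwise fun i j => D.block i ≤ D.block j := by
    rw [hl₁, List.pairwise_reverse, List.pairwise_map]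
    refine hl.imp fun {i j} h => ?_
    rw [hφb, hφb]
    have := D.block_mono h.le
    omega
  set l' := l₁.insertionSort (· ≤ ·)
  have hperm : l'.Perm l₁ := List.perm_insertionSort _ _
  have hl'le : l'.Pairwise (· ≤ ·) := List.pairwise_insertionSort _ _
  have hmem : ∀ i, i ∈ l' ↔ ∃ j ∈ l, φ j = i := by
    intro i
    rw [hperm.mem_iff, hl₁, List.mem_reverse, List.mem_map]
  have hl'range : ∀ i ∈ l', D.h - q ≤ D.block i ∧ D.block i ≤ D.h - p := by
    intro i hi
    obtain ⟨j, hj, rfl⟩ := (hmem i).1 hi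
    have := hlb j hj
    rw [hφb]
    omega
  have hρl : ∀ i ∈ l, D.rho i = D.cycRoot i := fun i hi =>
    D.rho_eq_of_block (hp.trans (hlb i hi).1)
  have hρl' : ∀ i ∈ l', D.rho i = D.cycRoot i := fun i hi =>
    D.rho_eq_of_block (by have := hl'range i hi; omega)
  refine ⟨l', ?_, hl'range, ?_, ?_, ?_⟩
  · have h1 := hl'le.and (hperm.nodup_iff.2 hnodup)
    exact h1.imp fun h => lt_of_le_of_ne h.1 h.2
  · ext v
    simp only [rootSet, List.mem_toFinset, List.mem_map, Finset.mem_image]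
    constructor
    · rintro ⟨i, hi, rfl⟩
      obtain ⟨j, hj, rfl⟩ := (hmem i).1 hi
      exact ⟨_, ⟨j, hj, rfl⟩, by rw [hρl' _ hi, hφ, hρl j hj]⟩
    · rintro ⟨_, ⟨j, hj, rfl⟩, rfl⟩
      have hi := (hmem (φ j)).2 ⟨j, hj, rfl⟩
      exact ⟨φ j, hi, by rw [hρl' _ hi, hφ, hρl j hj]⟩
  · rw [hperm.length_eq, hl₁, List.length_reverse, List.length_map]
  · have h1 : (l'.map fun i => R (D.rho i)) = l'.map fun i => R (D.cycRoot i) :=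
      List.map_congr_left fun i hi => by rw [hρl' i hi]
    have h2 : (l.map fun i => R (D.rho i)) = (l.map D.cycRoot).map R := by
      rw [List.map_map]
      exact List.map_congr_left fun i hi => by rw [hρl i hi]; rfl
    have h3 : (l₁.map fun i => R (D.cycRoot i))
        = (l.map D.cycRoot).reverse.map fun τ => R (D.cPlus τ) := by
      rw [hl₁, ← List.map_reverse, ← List.map_reverse, List.map_map, List.map_map]
      exact List.map_congr_left fun i _ => by simp only [Function.comp_apply, hφ]
    have h4 := prod_map_eq_of_perm (fun i => R (D.cycRoot i)) D.block
      (fun i j => D.commute_of_block_eq) hperm (hl'le.imp fun h => D.block_mono h) hl₁b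
    rw [len, len, h1, h4, h3, reflLength_map_cPlus, h2]

open Classical in
/-- The simplices of `AX(c)`, described through the list of its own vertices. -/
theorem mem_AX_iff (F : Finset (Euc n)) :
    F ∈ D.AX.faces ↔ ∃ l : List ℤ, l ≠ [] ∧ l.Pairwise (· < ·) ∧
      (∀ i ∈ l, 1 ≤ i ∧ i ≤ ((n * D.h / 2 + n : ℕ) : ℤ)) ∧
      D.len l + l.length = n ∧ F = D.rootSet l := by
  have hne : ∀ {l l' : List ℤ}, l'.length = l.length → l ≠ [] → l' ≠ [] := by
    intro l l' h h0 h1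
    rw [h1] at h
    exact h0 (List.eq_nil_of_length_eq_zero h.symm)
  constructor
  · rintro ⟨E, ⟨l, h0, hl, hr, hlen, rfl⟩, rfl⟩
    obtain ⟨l', h1, h2, h3, h4, h5⟩ := D.exists_reflected_list (p := -1) (q := D.h) le_rfl
      (by omega) (by omega) hl fun i hi => ⟨(D.neg_one_le_block_iff i).2 (hr i hi).1,
        (D.block_le_h_iff i).2 (hr i hi).2⟩
    refine ⟨l', hne h4 h0, h1, fun i hi => ?_, by rw [h4, h5, hlen], h3.symm⟩
    have := h2 i hi
    rw [← D.zero_le_block_iff, ← D.block_le_h_add_one_iff]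
    omega
  · rintro ⟨l, h0, hl, hr, hlen, rfl⟩
    obtain ⟨l', h1, h2, h3, h4, h5⟩ := D.exists_reflected_list (p := 0) (q := D.h + 1) (by omega)
      (by omega) (by omega) hl fun i hi => ⟨(D.zero_le_block_iff i).2 (hr i hi).1,
        (D.block_le_h_add_one_iff i).2 (hr i hi).2⟩
    refine ⟨D.rootSet l', ⟨l', hne h4 h0, h1, fun i hi => ?_, by rw [h4, h5, hlen], rfl⟩, ?_⟩
    · have := h2 i hi
      rw [← D.neg_one_le_block_iff, ← D.block_le_h_iff]
      omega
    · change (D.rootSet l').image D.cPlus = _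
      rw [h3, Finset.image_image]
      have : (D.cPlus ∘ D.cPlus : Euc n → Euc n) = id := funext D.cPlus_cPlus
      rw [this, Finset.image_id]

theorem rho_injOn : Set.InjOn D.rho (Set.Icc (1 : ℤ) ((n * D.h / 2 + n : ℕ) : ℤ)) := by
  rintro i ⟨hi1, hi2⟩ j ⟨hj1, hj2⟩ h
  rw [← D.zero_le_block_iff] at hi1 hj1
  rw [← D.block_le_h_add_one_iff] at hi2 hj2
  rw [D.rho_eq_of_block (by omega), D.rho_eq_of_block (by omega)] at h
  have := D.two_le_h
  exact D.cycRoot_inj h (by omega) (by omega)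

theorem le_reflLength_mul_c {T : Orth n} (hT : T ∈ reflections D.W) :
    n ≤ reflLength D.W (T * D.c) + 1 := by
  have hne : {k | ∃ m : List (Orth n), (∀ T ∈ m, T ∈ reflections D.W) ∧
      m.prod = T * D.c ∧ m.length = k}.Nonempty := by
    obtain ⟨m, h1, h2⟩ := exists_list D.isIrreducible.generated (D.W.mul_mem hT.1 D.c_mem)
    exact ⟨_, m, h1, h2, rfl⟩
  obtain ⟨m, hm, hmp, hml⟩ := Nat.sInf_mem hne
  have h1 := D.le_length (T :: m) (by simpa using ⟨hT, hm⟩)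
    (by rw [List.prod_cons, hmp, ← mul_assoc, mul_self_of_mem hT, one_mul])
  rw [List.length_cons, hml] at h1
  exact h1

/-- Every root in the list is a vertex: it is conjugate under a power of `c` to a simple root, and a
simple reflection occurs in the product `c`. -/
theorem reflLength_R_cycRoot_mul_c (i : ℤ) : reflLength D.W (R (D.cycRoot i) * D.c) + 1 = n := by
  have hconj : ∃ k : ℤ, R (D.cycRoot i) = D.c ^ k * R (D.α (D.pos i)) * (D.c ^ k)⁻¹ := by
    unfold cycRoot orbitRoot
    split_ifs
    · exact ⟨turn n i, by rw [conj_R]⟩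
    · exact ⟨turn n i + 1, by rw [conj_R, R_neg]⟩
  obtain ⟨k, hk⟩ := hconj
  set r := D.pos i
  have h1 : R (D.cycRoot i) * D.c = D.c ^ k * (R (D.α r) * D.c) * (D.c ^ k)⁻¹ := by
    rw [hk]
    group
  refine le_antisymm ?_ (D.le_reflLength_mul_c (D.R_cycRoot_mem i))
  rw [h1, reflLength_conj (D.W.zpow_mem D.c_mem k)]
  have hrefl : ∀ T ∈ (List.finRange n).map fun i => R (D.α i), T ∈ reflections D.W := by
    intro T hT
    obtain ⟨j, -, rfl⟩ := List.mem_map.1 hT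
    exact ⟨D.R_α_mem j, _, D.α_ne j, rfl⟩
  obtain ⟨t, ht, htl, htp⟩ := sublist_prod (l' := [R (D.α r)])
    (List.singleton_sublist.2 (List.mem_map.2 ⟨r, List.mem_finRange r, rfl⟩)) hrefl
  rw [List.prod_singleton] at htp
  change _ = t.prod * D.c at htp
  simp only [List.length_map, List.length_finRange, List.length_singleton] at htl
  -- the word `t` represents `R(α) c⁻¹`, which is conjugate to the inverse of `R(α) c`
  have h2 : R (D.α r) * D.c = D.c⁻¹ * t.prod⁻¹ * D.c⁻¹⁻¹ := by
    have h3 : t.prod = R (D.α r) * D.c⁻¹ := by rw [htp, mul_inv_cancel_right]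
    have h4 : (R (D.α r))⁻¹ = R (D.α r) := inv_eq_of_mul_eq_one_left (R_mul_self _)
    rw [h3, mul_inv_rev, h4, inv_inv, inv_mul_cancel_left]
  rw [h2, reflLength_conj (D.W.inv_mem D.c_mem), reflLength_inv]
  have h5 : reflLength D.W t.prod ≤ t.length := Nat.sInf_le ⟨t, ht, rfl, rfl⟩
  omega

theorem vertices_AX :
    vertices D.AX = D.rho '' Set.Icc (1 : ℤ) ((n * D.h / 2 + n : ℕ) : ℤ) := by
  classical
  ext v
  change {v} ∈ D.AX.faces ↔ _
  rw [mem_AX_iff]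
  constructor
  · rintro ⟨l, -, -, hr, -, he⟩
    have hv : v ∈ D.rootSet l := by rw [← he]; simp
    simp only [rootSet, List.mem_toFinset, List.mem_map] at hv
    obtain ⟨i, hi, rfl⟩ := hv
    exact ⟨i, hr i hi, rfl⟩
  · rintro ⟨i, hi, rfl⟩
    have h0 : -1 ≤ D.block i := by
      have := (D.zero_le_block_iff i).2 hi.1
      omega
    refine ⟨[i], by simp, by simp, by simpa using hi, ?_, by simp [rootSet]⟩
    rw [len, List.map_singleton, List.prod_singleton, D.rho_eq_of_block h0]
    exact D.reflLength_R_cycRoot_mul_c i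

theorem rootSet_injective {l l' : List ℤ} (hl : l.Pairwise (· < ·)) (hl' : l'.Pairwise (· < ·))
    (hr : ∀ i ∈ l, i ∈ Set.Icc (1 : ℤ) ((n * D.h / 2 + n : ℕ) : ℤ))
    (hr' : ∀ i ∈ l', i ∈ Set.Icc (1 : ℤ) ((n * D.h / 2 + n : ℕ) : ℤ))
    (h : D.rootSet l = D.rootSet l') : l = l' := by
  classical
  have hsub : ∀ {l l' : List ℤ}, (∀ i ∈ l, i ∈ Set.Icc (1 : ℤ) ((n * D.h / 2 + n : ℕ) : ℤ)) →
      (∀ i ∈ l', i ∈ Set.Icc (1 : ℤ) ((n * D.h / 2 + n : ℕ) : ℤ)) →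
      D.rootSet l = D.rootSet l' → ∀ i ∈ l, i ∈ l' := by
    intro l l' hr hr' h i hi
    have hv : D.rho i ∈ D.rootSet l' := by
      rw [← h]
      simp only [rootSet, List.mem_toFinset, List.mem_map]
      exact ⟨i, hi, rfl⟩
    simp only [rootSet, List.mem_toFinset, List.mem_map] at hv
    obtain ⟨j, hj, he⟩ := hv
    rwa [← D.rho_injOn (hr' j hj) (hr i hi) he]
  have hperm : l.Perm l' := (List.perm_ext_iff_of_nodup (hl.imp fun h => h.ne)
    (hl'.imp fun h => h.ne)).2 fun i => ⟨hsub hr hr' h i, hsub hr' hr h.symm i⟩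
  exact hperm.eq_of_pairwise (fun a b _ _ h1 h2 => absurd h1 h2.not_gt) hl hl'

end Setting

end BipartiteCoxeter

theorem mainTheorem6 {n : ℕ} (D : BipartiteCoxeter.Setting n) :
    Set.InjOn D.rho (Set.Icc (1 : ℤ) ((n * D.h / 2 + n : ℕ) : ℤ)) ∧
    BipartiteCoxeter.vertices D.AX = D.rho '' Set.Icc (1 : ℤ) ((n * D.h / 2 + n : ℕ) : ℤ) ∧
    ∀ l : List ℤ, l ≠ [] → l.Pairwise (· < ·) →
      (∀ i ∈ l, 1 ≤ i ∧ i ≤ ((n * D.h / 2 + n : ℕ) : ℤ)) →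
      (D.rootSet l ∈ D.AX.faces ↔
        (BipartiteCoxeter.reflLength D.W
          ((l.map fun i => BipartiteCoxeter.R (D.rho i)).prod * D.c) : ℤ) = n - l.length) := by
  refine ⟨D.rho_injOn, D.vertices_AX, fun l hne hl hr => ?_⟩
  have hlen : (BipartiteCoxeter.reflLength D.W
      ((l.map fun i => BipartiteCoxeter.R (D.rho i)).prod * D.c) : ℤ) = n - l.length ↔
      D.len l + l.length = n := by
    unfold BipartiteCoxeter.Setting.len
    omega
  rw [hlen, D.mem_AX_iff]
  constructor
  · rintro ⟨l', -, hl', hr', hlen', he⟩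
    rwa [D.rootSet_injective hl hl' hr hr' he]
  · intro h
    exact ⟨l, hne, hl, hr, h, rfl⟩
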